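/- Let $k$ be a field, let $X,Y$ be two disjoint finite sets of variables and let $\prec$ be a term order on the monomials $\mathbb T_{X,Y}$ of $k[X,Y]$. For a monomial $\mathbf n$ put $\mathrm{tail}(\mathbf n)=\{\mathbf v\in\mathbb T_{X,Y} : \mathbf v\prec\mathbf n\}$ and $\mathrm{htail}(\mathbf n)=\{\mathbf v\in\mathrm{tail}(\mathbf n) : \deg\mathbf v=\deg\mathbf n\}$; the order is reliable if all tails are finite. It is an elimination order of $Y$ if every monomial involving a variable of $Y$ is larger than every monomial in the variables $X$ only. Strata. Let $I$ be a monomial ideal of $k[X,Y]$ with minimal monomial generators $\mathbf u_1,\dots,\mathbf u_s$, and let $I'$ be a monomial ideal. Assume that $\prec$ is reliable. Take new variables $c_{i\mathbf v}$, one for each $i$ and each $\mathbf v\in\mathrm{tail}(\mathbf u_i)\setminus(I\cup I')$, let $C$ be the set of all of them, and put $F_i=\mathbf u_i+\sum_{\mathbf v}c_{i\mathbf v}\mathbf v\in k[C][X,Y]$. For $i<j$ let $H_{ij}$ be a complete reduction of the $S$-polynomial of $F_i,F_j$ with respect to $F_1,\dots,F_s$ (so no monomial in $X,Y$ occurring in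 $H_{ij}$ lies in $I$). The stratum $\mathcal St(I/I')$ is the closed subscheme of $\mathrm{Spec}\,k[C]$ defined by the ideal generated by the coefficients in $k[C]$ of all the $H_{ij}$, and $\mathcal St(I)=\mathcal St(I/(0))$. The homogeneous strata $\mathcal St_h(I/I')$ and $\mathcal St_h(I)$ are defined in the same way, for an arbitrary term order, with $\mathrm{htail}$ in place of $\mathrm{tail}$. Theorem. Let $J_0\neq(0)$ be an ideal of $k[X,Y]$ generated by monomials in the variables $X$, let $\mathbf m,\mathbf n_0$ be monomials in the variables $Y$, and let $$J=\mathbf m\bigl((\mathbf n_0)+J_0\bigr).$$ Assume that either $\mathbf n_0$ has degree $1$ or $\prec$ is an elimination order of $Y$. Let $N_0\geq 0$ be an integer. (1) If $\prec$ is reliable and $\mathcal St(J_0/(\mathbf n_0))\cong\mathbb A^{N_0}$ over $k$, then $\mathcal St(J)\cong\mathbb A^{N_0+N_1+N_2}$ over $k$, where $N_1=|\mathrm{tail}(\mathbf m)|$ and $N_2=|\mathrm{tail}(\mathbf n_0)\setminus J_0|$. (2) If $\mathcal St_h(J_0/(\mathbf n_0))\cong\mathbb A^{N_0}$ over $k$,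 then $\mathcal St_h(J)\cong\mathbb A^{N_0+N_1+N_2}$ over $k$, where $N_1=|\mathrm{htail}(\mathbf m)|$ and $N_2=|\mathrm{htail}(\mathbf n_0)\setminus J_0|$. The assertions hold for every choice of the reductions $H_{ij}$ used to define the strata. -/

import Mathlib

open MvPolynomial AlgebraicGeometry CategoryTheory
open scoped MonomialOrder

namespace Strata

universe u v

noncomputable section

/-! Monomials of `k[σ]` are identified with their exponents in `σ →₀ ℕ`; a term order on the monomials
in the finite set of variables `σ` is a `MonomialOrder σ`. -/

/-- The tail of a monomial: all strictly smaller monomials. -/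
def tail {σ : Type} (ord : MonomialOrder.{0, v} σ) (a : σ →₀ ℕ) : Set (σ →₀ ℕ) :=
  {b | b ≺[ord] a}

/-- The homogeneous tail: all strictly smaller monomials of the same degree. -/
def htail {σ : Type} (ord : MonomialOrder.{0, v} σ) (a : σ →₀ ℕ) : Set (σ →₀ ℕ) :=
  {b | b ≺[ord] a ∧ b.degree = a.degree}

/-- A term order is reliable if every monomial has a finite tail. -/
def Reliable {σ : Type} (ord : MonomialOrder.{0, v} σ) : Prop :=
  ∀ a : σ →₀ ℕ, (tail ord a).Finite

/-- `ord` is an elimination order of the variables `Y`: every monomial in which some variable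
of `Y` occurs is larger than every monomial in the variables `X` only. -/
def Eliminates {X Y : Type} (ord : MonomialOrder.{0, v} (X ⊕ Y)) : Prop :=
  ∀ a b : X ⊕ Y →₀ ℕ, (∀ y, a (Sum.inr y) = 0) → (∃ y, b (Sum.inr y) ≠ 0) → a ≺[ord] b

variable {k : Type u} [Field k] {σ : Type}

/-- The monomials that belong to an ideal. -/
def mons (J : Ideal (MvPolynomial σ k)) : Set (σ →₀ ℕ) :=
  {a | monomial a (1 : k) ∈ J}

/-- The monomial basis of a monomial ideal: its minimal monomials for divisibility. -/
def monBasis (J : Ideal (MvPolynomial σ k)) : Set (σ →₀ ℕ) :=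
  {a | Minimal (· ∈ mons J) a}

/-- The index set of the new variables `c_{a,b}`, where `a` runs over the monomial basis of `J` and
`b` over the set `T a` of monomials that are allowed in the polynomial with head `a`. -/
abbrev Params (J : Ideal (MvPolynomial σ k)) (T : (σ →₀ ℕ) → Set (σ →₀ ℕ)) : Type :=
  Σ a : monBasis J, T a.1

/-- The polynomial `F_a = X^a + ∑ c_{a,b} X^b`, the sum over `b ∈ T a`, with coefficients in `k[C]`.
The sets `T a` are finite whenever this is used (reliable orders, or homogeneous tails). -/
def genericPoly (J : Ideal (MvPolynomial σ k)) (T : (σ →₀ ℕ) → Set (σ →₀ ℕ)) (a : monBasis J) :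
    MvPolynomial σ (MvPolynomial (Params J T) k) :=
  monomial a.1 1 + ∑ᶠ b : T a.1, monomial b.1 (X (⟨a, b⟩ : Params J T))

/-- The `S`-polynomial of `F_a` and `F_b`, whose leading monomials are `X^a` and `X^b`;
`a ⊔ b` is the exponent of the least common multiple. -/
def genericSPoly (J : Ideal (MvPolynomial σ k)) (T : (σ →₀ ℕ) → Set (σ →₀ ℕ)) (a b : monBasis J) :
    MvPolynomial σ (MvPolynomial (Params J T) k) :=
  monomial (a.1 ⊔ b.1 - a.1) 1 * genericPoly J T a - monomial (a.1 ⊔ b.1 - b.1) 1 * genericPoly J T b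

/-- `r` is a complete reduction of `f` by the polynomials `F_a`: `f - r` is a combination of the `F_a`
none of whose terms has a leading monomial exceeding that of `f`, and no monomial of `r` is
divisible by a leading monomial `X^a`. -/
def IsReduction (ord : MonomialOrder.{0, v} σ) (J : Ideal (MvPolynomial σ k))
    (T : (σ →₀ ℕ) → Set (σ →₀ ℕ)) (f r : MvPolynomial σ (MvPolynomial (Params J T) k)) : Prop :=
  ∃ g : monBasis J →₀ MvPolynomial σ (MvPolynomial (Params J T) k),
    f = Finsupp.linearCombination _ (genericPoly J T) g + r ∧
    (∀ a, ord.degree (genericPoly J T a * g a) ≼[ord] ord.degree f) ∧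
    ∀ c ∈ r.support, ∀ a : monBasis J, ¬ a.1 ≤ c

/-- A choice of a complete reduction `H_{ab}` of the `S`-polynomial of each pair `F_a`, `F_b`;
each unordered pair is listed once, in the order given by `ord`. -/
structure SReductions (ord : MonomialOrder.{0, v} σ) (J : Ideal (MvPolynomial σ k))
    (T : (σ →₀ ℕ) → Set (σ →₀ ℕ)) where
  /-- The reductions; only the values at pairs with `a ≺ b` matter. -/
  H : monBasis J → monBasis J → MvPolynomial σ (MvPolynomial (Params J T) k)
  isReduction : ∀ a b : monBasis J, a.1 ≺[ord] b.1 →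
    IsReduction ord J T (genericSPoly J T a b) (H a b)

/-- The ideal of `k[C]` generated by the coefficients in `k[C]` of the monomials in the
original variables that appear in the `H_{ab}`. -/
def stratumIdeal {ord : MonomialOrder.{0, v} σ} {J : Ideal (MvPolynomial σ k)}
    {T : (σ →₀ ℕ) → Set (σ →₀ ℕ)} (R : SReductions ord J T) : Ideal (MvPolynomial (Params J T) k) :=
  Ideal.span {c | ∃ a b : monBasis J, a.1 ≺[ord] b.1 ∧ ∃ e : σ →₀ ℕ, c = (R.H a b).coeff e}

/-- The stratum: the closed subscheme of the affine space with coordinates `C` defined by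
the ideal above, as a scheme over `k`. -/
def stratum {ord : MonomialOrder.{0, v} σ} {J : Ideal (MvPolynomial σ k)}
    {T : (σ →₀ ℕ) → Set (σ →₀ ℕ)} (R : SReductions ord J T) : Over (Spec (CommRingCat.of k)) :=
  Over.mk (Spec.map (CommRingCat.ofHom
    (algebraMap k (MvPolynomial (Params J T) k ⧸ stratumIdeal R))))

/-- `Z` is isomorphic over `k` to the affine space of dimension `N`. -/
def IsAffineSpace (Z : Over (Spec (CommRingCat.of k))) (N : ℕ) : Prop :=
  Nonempty (Z ≅ Over.mk (𝔸(ULift.{u} (Fin N); Spec (CommRingCat.of k)) ↘ Spec (CommRingCat.of k)))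

/-- The monomials allowed in the definition of the stratum `St(J / J')`: those of `tail a` that are
not in `J` or `J'`. For `J' = ⊥` this gives `St(J)`. -/
def stTails (ord : MonomialOrder.{0, v} σ) (J J' : Ideal (MvPolynomial σ k)) (a : σ →₀ ℕ) :
    Set (σ →₀ ℕ) :=
  tail ord a \ (mons J' ∪ mons J)

/-- The same for the homogeneous stratum `St_h(J / J')`. -/
def sthTails (ord : MonomialOrder.{0, v} σ) (J J' : Ideal (MvPolynomial σ k)) (a : σ →₀ ℕ) :
    Set (σ →₀ ℕ) :=
  htail ord a \ (mons J' ∪ mons J)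

/-- Complete reductions of the `S`-polynomials always exist. -/
theorem nonempty_sReductions (ord : MonomialOrder.{0, v} σ) (J : Ideal (MvPolynomial σ k))
    (T : (σ →₀ ℕ) → Set (σ →₀ ℕ)) (hT : ∀ a, T a ⊆ tail ord a) :
    Nonempty (SReductions ord J T) := by
  classical
  have hsum : ∀ a : monBasis J, ∀ c, ¬ c ≺[ord] a.1 →
      (∑ᶠ b : T a.1, monomial b.1 (X (⟨a, b⟩ : Params J T) : MvPolynomial (Params J T) k)).coeff c
        = 0 := by
    intro a c hc
    refine finsum_induction (fun p : MvPolynomial σ (MvPolynomial (Params J T) k) => p.coeff c = 0)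
      (by simp) (by intro p q hp hq; simp [hp, hq]) ?_
    intro b
    rw [coeff_monomial, if_neg]
    rintro rfl
    exact hc (hT _ b.2)
  have hcoeff : ∀ a : monBasis J, (genericPoly J T a).coeff a.1 = 1 := by
    intro a
    simp [genericPoly, hsum a a.1 (lt_irrefl _)]
  have hdeg : ∀ a : monBasis J, ord.degree (genericPoly J T a) = a.1 := by
    intro a
    apply ord.toSyn.injective
    apply le_antisymm
    · rw [MonomialOrder.degree_le_iff]
      intro c hc
      by_contra hlt
      have hlt' : ord.toSyn a.1 < ord.toSyn c := not_le.mp hlt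
      have hne : a.1 ≠ c := by rintro h; rw [h] at hlt'; exact lt_irrefl _ hlt'
      rw [mem_support_iff] at hc
      apply hc
      simp [genericPoly, coeff_monomial, hne, hsum a c hlt'.not_gt]
    · apply ord.le_degree
      rw [mem_support_iff, hcoeff]
      exact one_ne_zero
  have hunit : ∀ a : monBasis J, IsUnit (ord.leadingCoeff (genericPoly J T a)) := by
    intro a
    rw [MonomialOrder.leadingCoeff, hdeg, hcoeff]
    exact isUnit_one
  have key : ∀ f, ∃ r, IsReduction ord J T f r := by
    intro f
    obtain ⟨g, r, h1, h2, h3⟩ := ord.div hunit f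
    exact ⟨r, g, h1, h2, fun c hc a => by rw [← hdeg a]; exact h3 c hc a⟩
  choose r hr using key
  exact ⟨⟨fun a b => r (genericSPoly J T a b), fun a b _ => hr _⟩⟩

end

end Strata

namespace Strata

universe u v

noncomputable section

/-! Write `F_u` for the polynomials of a point of `St(J₀/(n₀))`, and let `f`, `g` have heads `m`,
`n₀` and coefficient one there, the tail of `g` avoiding `J₀`. These data give the ideal `f · ((F_u)
+ (g))`. Since `J₀` is generated in the variables `X` and `n₀` involves only `Y`, `n₀` is a
nonzerodivisor modulo `J₀`; hence leading terms do not cancel and the leading monomials of the ideal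
are exactly those of `J`. Its reduced basis defines a morphism from `St(J₀/(n₀)) × 𝔸^{N₁+N₂}` to
`St(J)`, and the point is that this is an isomorphism.

Strata are handled through their points: a specialization of the parameters kills the stratum ideal
precisely when the specialized polynomials generate an ideal with all leading monomials in `J`
(`leadIn_specIdeal`, `stratumIdeal_le_ker`). This is a form of Buchberger's criterion, and it makes
the choice of reductions irrelevant.

No inverse is constructed. Rescaling the variables gives a torus action on the stratum for which
`c_{a,b}` has weight `a - b`, and this is positive for the order because `b ≺ a`. A graded Nakayama
argument then shows that weight vectors which separate the tangent vectors at the origin generate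
the whole ring (`adjoin_eq_top_of_coaction`). It is used twice. The homomorphism of coordinate rings
is surjective because the derivative of the morphism at the origin is injective
(`eq_zero_of_heads_mem_prodIdeal`, `exists_surjective_product`). Also, the coordinate ring of
`St(J)` needs at most as many generators as the dimension of its tangent space
(`exists_surjective_of_finrank_le`).

That dimension is at most `N = N₀ + N₁ + N₂`. A tangent vector is a homomorphism from `J` to the
quotient by `J`; by `exists_common_factor` its part not divisible by `m` comes from deforming `f`
alone, and what remains deforms `g` and the `F_u` (`exists_productTangent_eq`).

So a polynomial ring in `N` variables maps onto the ring of `St(J)`, which maps onto another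
polynomial ring in `N` variables. A surjective endomorphism of a Noetherian ring is injective, so
both maps are isomorphisms. -/

/-- A relation on monomials that refines a term order and is compatible with multiplication; the
relations "`b` belongs to the tail of `a`" and "`b` belongs to the homogeneous tail of `a`" are
the examples of interest. -/
structure TailRel {σ : Type} (ord : MonomialOrder.{0, v} σ) (r : (σ →₀ ℕ) → (σ →₀ ℕ) → Prop) :
    Prop where
  lt : ∀ {b a}, r b a → b ≺[ord] a
  trans : ∀ {c b a}, r c b → r b a → r c a
  add_iff : ∀ {b a} (c), r (b + c) (a + c) ↔ r b a

theorem tailRel_lt {σ : Type} (ord : MonomialOrder.{0, v} σ) :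
    TailRel ord (fun b a => b ≺[ord] a) where
  lt h := h
  trans := lt_trans
  add_iff c := by simp

theorem tailRel_homogeneous {σ : Type} (ord : MonomialOrder.{0, v} σ) :
    TailRel ord (fun b a => b ≺[ord] a ∧ b.degree = a.degree) where
  lt h := h.1
  trans h h' := ⟨h.1.trans h'.1, h.2.trans h'.2⟩
  add_iff c := by simp [map_add]

/-! ### Heads, leading monomials and Buchberger's criterion over a commutative ring -/

section Lead

variable {σ : Type} {ord : MonomialOrder.{0, v} σ} {r : (σ →₀ ℕ) → (σ →₀ ℕ) → Prop}
  {A B : Type*} [CommRing A] [CommRing B]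

/-- `f = X^a + ` a combination of monomials `X^e` with `r e a`. -/
def HasHead (r : (σ →₀ ℕ) → (σ →₀ ℕ) → Prop) (a : σ →₀ ℕ) (f : MvPolynomial σ A) : Prop :=
  f.coeff a = 1 ∧ ∀ e, e ≠ a → f.coeff e ≠ 0 → r e a

theorem HasHead.map {a : σ →₀ ℕ} {f : MvPolynomial σ A} (h : HasHead r a f) (g : A →+* B) :
    HasHead r a (MvPolynomial.map g f) := by
  refine ⟨by simp [coeff_map, h.1], fun e he hc => h.2 e he ?_⟩
  rintro h0
  exact hc (by simp [coeff_map, h0])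

theorem HasHead.toLt (hr : TailRel ord r) {a : σ →₀ ℕ} {f : MvPolynomial σ A} (h : HasHead r a f) :
    HasHead (fun b a => b ≺[ord] a) a f :=
  ⟨h.1, fun e he hc => hr.lt (h.2 e he hc)⟩

theorem hasHead_monomial (a : σ →₀ ℕ) : HasHead r a (monomial a (1 : A)) := by
  classical
  refine ⟨by simp, fun e he hc => (hc ?_).elim⟩
  rw [coeff_monomial, if_neg he.symm]

theorem HasHead.degree_le (hr : TailRel ord r) {a : σ →₀ ℕ} {f : MvPolynomial σ A}
    (h : HasHead r a f) : ord.degree f ≼[ord] a := by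
  rw [MonomialOrder.degree_le_iff]
  intro e he
  rw [mem_support_iff] at he
  by_cases h1 : e = a
  · rw [h1]
  · exact (hr.lt (h.2 e h1 he)).le

theorem HasHead.degree_eq [Nontrivial A] (hr : TailRel ord r) {a : σ →₀ ℕ} {f : MvPolynomial σ A}
    (h : HasHead r a f) : ord.degree f = a := by
  apply ord.toSyn.injective
  apply le_antisymm (h.degree_le hr)
  apply ord.le_degree
  rw [mem_support_iff, h.1]
  exact one_ne_zero

theorem HasHead.leadingCoeff_eq [Nontrivial A] (hr : TailRel ord r) {a : σ →₀ ℕ}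
    {f : MvPolynomial σ A} (h : HasHead r a f) : ord.leadingCoeff f = 1 := by
  rw [MonomialOrder.leadingCoeff, h.degree_eq hr, h.1]

theorem HasHead.mul (hr : TailRel ord r) {a b : σ →₀ ℕ} {f g : MvPolynomial σ A}
    (hf : HasHead r a f) (hg : HasHead r b g) : HasHead r (a + b) (f * g) := by
  classical
  have key : ∀ e, ∀ x ∈ Finset.HasAntidiagonal.antidiagonal e, f.coeff x.1 * g.coeff x.2 ≠ 0 →
      x = (a, b) ∨ r e (a + b) := by
    intro e x hx hne
    rw [Finset.HasAntidiagonal.mem_antidiagonal] at hx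
    have h1 := left_ne_zero_of_mul hne
    have h2 := right_ne_zero_of_mul hne
    by_cases e1 : x.1 = a
    · by_cases e2 : x.2 = b
      · left; ext1 <;> assumption
      · right
        rw [← hx, e1, add_comm a, add_comm a, hr.add_iff]
        exact hg.2 _ e2 h2
    · right
      have h3 : r (x.1 + x.2) (a + x.2) := (hr.add_iff _).2 (hf.2 _ e1 h1)
      rw [← hx]
      by_cases e2 : x.2 = b
      · rwa [e2] at h3 ⊢
      · refine hr.trans h3 ?_
        rw [add_comm a, add_comm a, hr.add_iff]
        exact hg.2 _ e2 h2
  constructor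
  · rw [coeff_mul, Finset.sum_eq_single (a, b)]
    · simp [hf.1, hg.1]
    · intro x hx hne
      by_contra h0
      rcases key _ x hx h0 with h | h
      · exact hne h
      · exact absurd (hr.lt h) (lt_irrefl _)
    · intro h; simp at h
  · intro e he hc
    rw [coeff_mul] at hc
    obtain ⟨x, hx, hne⟩ := Finset.exists_ne_zero_of_sum_ne_zero hc
    rcases key _ x hx hne with h | h
    · rw [Finset.HasAntidiagonal.mem_antidiagonal, h] at hx
      exact absurd hx.symm he
    · exact h

theorem HasHead.monomial_mul (hr : TailRel ord r) {a : σ →₀ ℕ} {f : MvPolynomial σ A}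
    (hf : HasHead r a f) (c : σ →₀ ℕ) : HasHead r (c + a) (monomial c 1 * f) :=
  (hasHead_monomial c).mul hr hf

/-- The nonzero elements of the ideal have their leading monomials in `M`. -/
def LeadIn (ord : MonomialOrder.{0, v} σ) (M : Set (σ →₀ ℕ)) (𝔞 : Ideal (MvPolynomial σ A)) : Prop :=
  ∀ b ∈ 𝔞, b ≠ 0 → ord.degree b ∈ M

/-- Uniqueness of normal forms: a nonzero element has a nonzero coefficient at its leading monomial,
and that monomial lies in `M`. -/
theorem LeadIn.eq_zero {M : Set (σ →₀ ℕ)} {𝔞 : Ideal (MvPolynomial σ A)} (h : LeadIn ord M 𝔞)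
    {b : MvPolynomial σ A} (hb : b ∈ 𝔞) (hs : ∀ e ∈ M, b.coeff e = 0) : b = 0 := by
  by_contra h0
  have := h b hb h0
  exact MonomialOrder.coeff_degree_ne_zero_iff.2 h0 (hs _ this)

/-- The multiples of the `F i` whose formal leading monomial is smaller than `w`. -/
def belowSpan (ord : MonomialOrder.{0, v} σ) {ι : Type*} (a : ι → σ →₀ ℕ) (F : ι → MvPolynomial σ A)
    (w : σ →₀ ℕ) : Submodule A (MvPolynomial σ A) :=
  Submodule.span A {p | ∃ c i, (c + a i ≺[ord] w) ∧ p = monomial c 1 * F i}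

theorem monomial_mul_mem_belowSpan {ι : Type*} {a : ι → σ →₀ ℕ} {F : ι → MvPolynomial σ A}
    {w : σ →₀ ℕ} {p : MvPolynomial σ A} (hp : p ∈ belowSpan ord a F w) (c : σ →₀ ℕ) :
    monomial c 1 * p ∈ belowSpan ord a F (c + w) := by
  induction hp using Submodule.span_induction with
  | mem x hx =>
    obtain ⟨d, i, h, rfl⟩ := hx
    refine Submodule.subset_span ⟨c + d, i, ?_, ?_⟩
    · rw [add_assoc, map_add, map_add ord.toSyn c w]
      exact add_lt_add_right h _
    · rw [← mul_assoc, monomial_mul, one_mul]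
  | zero => simp
  | add x y _ _ hx hy => rw [mul_add]; exact add_mem hx hy
  | smul t x _ hx => rw [mul_smul_comm]; exact Submodule.smul_mem _ _ hx

theorem mem_span_monomial_mul {ι : Type*} {F : ι → MvPolynomial σ A} {f : MvPolynomial σ A}
    (hf : f ∈ Ideal.span (Set.range F)) :
    f ∈ Submodule.span A {p | ∃ c i, p = monomial c 1 * F i} := by
  induction hf using Submodule.span_induction with
  | mem x hx =>
    obtain ⟨i, rfl⟩ := hx
    exact Submodule.subset_span ⟨0, i, by simp⟩
  | zero => simp
  | add x y _ _ hx hy => exact add_mem hx hy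
  | smul t x _ hx =>
    rw [smul_eq_mul]
    clear * - hx
    induction hx using Submodule.span_induction with
    | mem x hx =>
      obtain ⟨c, i, rfl⟩ := hx
      rw [t.as_sum, Finset.sum_mul]
      refine sum_mem fun e _ => ?_
      have : monomial e (t.coeff e) * (monomial c 1 * F i)
          = t.coeff e • (monomial (e + c) (1 : A) * F i) := by
        rw [← mul_assoc, monomial_mul, mul_one, ← smul_mul_assoc, smul_monomial, smul_eq_mul, mul_one]
      rw [this]
      exact Submodule.smul_mem _ _ (Submodule.subset_span ⟨_, _, rfl⟩)
    | zero => simp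
    | add x y _ _ hx hy => rw [mul_add]; exact add_mem hx hy
    | smul s x _ hx => rw [mul_smul_comm]; exact Submodule.smul_mem _ _ hx

/-- A combination of polynomials with heads in `M`, one for each element of `M`, has its leading
monomial in `M`. -/
theorem degree_mem_of_mem_span {M : Set (σ →₀ ℕ)} {E : M → MvPolynomial σ A}
    (hE : ∀ w : M, HasHead (fun b a => b ≺[ord] a) w.1 (E w))
    {f : MvPolynomial σ A} (hf : f ∈ Submodule.span A (Set.range E)) (h0 : f ≠ 0) :
    ord.degree f ∈ M := by
  classical
  obtain ⟨c, rfl⟩ := (Finsupp.mem_span_range_iff_exists_finsupp).1 hf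
  have hne : c.support.Nonempty := by
    rw [Finset.nonempty_iff_ne_empty, Ne, Finsupp.support_eq_empty]
    rintro rfl
    simp at h0
  obtain ⟨w, hw, hmax⟩ := c.support.exists_max_image (fun w => ord.toSyn w.1) hne
  have hco : ∀ e, (c.sum fun i a => a • E i).coeff e = ∑ i ∈ c.support, c i * (E i).coeff e := by
    intro e
    simp [Finsupp.sum, coeff_sum]
  suffices h : ord.degree (c.sum fun i a => a • E i) = w.1 by rw [h]; exact w.2
  apply ord.toSyn.injective
  apply le_antisymm
  · rw [MonomialOrder.degree_le_iff]
    intro e he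
    by_contra hlt
    rw [not_le] at hlt
    rw [mem_support_iff, hco] at he
    obtain ⟨i, hi, hne⟩ := Finset.exists_ne_zero_of_sum_ne_zero he
    have h1 := right_ne_zero_of_mul hne
    by_cases hei : e = i.1
    · rw [hei] at hlt; exact absurd (hmax i hi) (not_le.2 hlt)
    · exact absurd (((hE i).2 e hei h1).le.trans (hmax i hi)) (not_le.2 hlt)
  · apply ord.le_degree
    rw [mem_support_iff, hco, Finset.sum_eq_single w]
    · rw [(hE w).1, mul_one]; exact Finsupp.mem_support_iff.1 hw
    · intro i hi hiw
      by_contra hne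
      have h1 := right_ne_zero_of_mul hne
      have : w.1 ≠ i.1 := fun h => hiw (Subtype.ext h.symm)
      exact absurd ((hE i).2 _ this h1) (not_lt.2 (hmax i hi))
    · intro h; exact absurd hw h

/-- Buchberger's criterion for polynomials with leading coefficient one over a commutative ring. -/
theorem leadIn_of_sPoly {ι : Type*} {a : ι → σ →₀ ℕ} {F : ι → MvPolynomial σ A}
    (hF : ∀ i, HasHead (fun b a => b ≺[ord] a) (a i) (F i))
    (hS : ∀ i j, monomial (a i ⊔ a j - a i) 1 * F i - monomial (a i ⊔ a j - a j) 1 * F j ∈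
      belowSpan ord a F (a i ⊔ a j)) :
    LeadIn ord {w | ∃ i, a i ≤ w} (Ideal.span (Set.range F)) := by
  classical
  intro f hf h0
  have hidx : ∀ w : {w | ∃ i, a i ≤ w}, ∃ i, a i ≤ w.1 := fun w => w.2
  choose idx hidx using hidx
  -- One multiple is kept for each monomial of the ideal of heads. Any other multiple with the same
  -- head differs from it by a monomial times an S-polynomial, hence by multiples with smaller
  -- heads, and induction on the head applies.
  let E : {w | ∃ i, a i ≤ w} → MvPolynomial σ A :=
    fun w => monomial (w.1 - a (idx w)) 1 * F (idx w)
  have hE : ∀ w : {w | ∃ i, a i ≤ w}, HasHead (fun b a => b ≺[ord] a) w.1 (E w) := by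
    intro w
    have := (hF (idx w)).monomial_mul (tailRel_lt ord) (w.1 - a (idx w))
    rwa [tsub_add_cancel_of_le (hidx w)] at this
  have key : ∀ (s : ord.syn) (w : σ →₀ ℕ), ord.toSyn w = s → ∀ c i, c + a i = w →
      monomial c 1 * F i ∈ Submodule.span A (Set.range E) := by
    intro s
    induction s using WellFoundedLT.induction with
    | ind s ih =>
    rintro w rfl c i hc
    have hV : belowSpan ord a F w ≤ Submodule.span A (Set.range E) := by
      refine Submodule.span_le.2 ?_
      rintro p ⟨d, j, hlt, rfl⟩
      exact ih _ hlt _ rfl d j rfl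
    have hw : ∃ i, a i ≤ w := ⟨i, hc ▸ le_add_left le_rfl⟩
    let W : {w | ∃ i, a i ≤ w} := ⟨w, hw⟩
    have hi : a i ≤ w := hc ▸ le_add_left le_rfl
    have hj : a (idx W) ≤ w := hidx W
    have hsup : a i ⊔ a (idx W) ≤ w := sup_le hi hj
    have h1 := monomial_mul_mem_belowSpan (hS i (idx W)) (w - a i ⊔ a (idx W))
    rw [tsub_add_cancel_of_le hsup, mul_sub, ← mul_assoc, ← mul_assoc, monomial_mul, monomial_mul,
      tsub_add_tsub_cancel hsup le_sup_left, tsub_add_tsub_cancel hsup le_sup_right, one_mul] at h1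
    have h2 : monomial (w - a (idx W)) 1 * F (idx W) ∈ Submodule.span A (Set.range E) :=
      Submodule.subset_span ⟨W, rfl⟩
    have h3 := add_mem (hV h1) h2
    rw [sub_add_cancel] at h3
    rwa [← hc, add_tsub_cancel_right] at h3
  refine degree_mem_of_mem_span hE ?_ h0
  refine Submodule.span_le.2 ?_ (mem_span_monomial_mul hf)
  rintro p ⟨c, i, rfl⟩
  exact key _ _ rfl c i rfl

end Lead

/-! ### Points of the stratum -/

section Stratum

variable {k : Type u} [Field k] {σ : Type} {ord : MonomialOrder.{0, v} σ}
  {r : (σ →₀ ℕ) → (σ →₀ ℕ) → Prop} {A : Type*} [CommRing A]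
  {J : Ideal (MvPolynomial σ k)} {T : (σ →₀ ℕ) → Set (σ →₀ ℕ)}

theorem mons_upper {a b : σ →₀ ℕ} (h : a ∈ mons J) (hab : a ≤ b) : b ∈ mons J := by
  have := J.mul_mem_left (monomial (b - a) 1) h
  rwa [monomial_mul, tsub_add_cancel_of_le hab, one_mul] at this

theorem mem_mons_iff [Finite σ] {w : σ →₀ ℕ} : w ∈ mons J ↔ ∃ a : monBasis J, a.1 ≤ w := by
  constructor
  · intro h
    obtain ⟨a, ha, hm⟩ := exists_minimal_le_of_wellFoundedLT (· ∈ mons J) w h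
    exact ⟨⟨a, hm⟩, ha⟩
  · rintro ⟨a, ha⟩
    exact mons_upper a.2.1 ha

theorem finite_monBasis [Finite σ] : Finite (monBasis J) := by
  have := WellQuasiOrderedLE.finite_of_isAntichain (s := monBasis J) (setOfPred_minimal_antichain _)
  exact this

theorem coeff_genericPoly (hfin : ∀ a, (T a).Finite) (a : monBasis J) (ha : a.1 ∉ T a.1) (e : σ →₀ ℕ) :
    open Classical in (genericPoly J T a).coeff e =
      if e = a.1 then 1 else if h : e ∈ T a.1 then X (⟨a, ⟨e, h⟩⟩ : Params J T) else 0 := by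
  classical
  have := (hfin a.1).fintype
  rw [genericPoly, finsum_eq_sum_of_fintype, coeff_add, coeff_monomial, coeff_sum]
  simp only [coeff_monomial]
  by_cases he : e = a.1
  · rw [if_pos he.symm, if_pos he, Finset.sum_eq_zero, add_zero]
    intro b _
    rw [if_neg]
    rintro hb
    have hb2 : b.1 ∈ T a.1 := b.2
    rw [hb, he] at hb2
    exact ha hb2
  · rw [if_neg (Ne.symm he), if_neg he, zero_add]
    split_ifs with h
    · rw [Finset.sum_eq_single ⟨e, h⟩]
      · simp
      · intro b _ hb
        rw [if_neg]
        rintro rfl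
        exact hb rfl
      · simp
    · refine Finset.sum_eq_zero fun b _ => ?_
      rw [if_neg]
      rintro rfl
      exact h b.2

theorem hasHead_genericPoly (hr : TailRel ord r) (hfin : ∀ a, (T a).Finite)
    (hT : ∀ a, ∀ b ∈ T a, r b a) (a : monBasis J) : HasHead r a.1 (genericPoly J T a) := by
  classical
  have ha : a.1 ∉ T a.1 := fun h => lt_irrefl _ (hr.lt (hT _ _ h))
  constructor
  · rw [coeff_genericPoly hfin a ha, if_pos rfl]
  · intro e he hc
    rw [coeff_genericPoly hfin a ha, if_neg he] at hc
    by_cases h : e ∈ T a.1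
    · exact hT _ _ h
    · rw [dif_neg h] at hc; exact absurd rfl hc

/-- The ideal generated by a specialization of the generic polynomials. -/
def specIdeal (J : Ideal (MvPolynomial σ k)) (T : (σ →₀ ℕ) → Set (σ →₀ ℕ))
    (θ : MvPolynomial (Params J T) k →+* A) : Ideal (MvPolynomial σ A) :=
  Ideal.span (Set.range fun a : monBasis J => MvPolynomial.map θ (genericPoly J T a))

theorem map_genericSPoly (θ : MvPolynomial (Params J T) k →+* A) (a b : monBasis J) :
    MvPolynomial.map θ (genericSPoly J T a b) =
      monomial (a.1 ⊔ b.1 - a.1) 1 * MvPolynomial.map θ (genericPoly J T a) -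
      monomial (a.1 ⊔ b.1 - b.1) 1 * MvPolynomial.map θ (genericPoly J T b) := by
  simp [genericSPoly]

theorem degree_genericSPoly_lt (hr : TailRel ord r) (hfin : ∀ a, (T a).Finite)
    (hT : ∀ a, ∀ b ∈ T a, r b a) {a b : monBasis J} (hab : a.1 ≺[ord] b.1) :
    ord.degree (genericSPoly J T a b) ≺[ord] (a.1 ⊔ b.1) := by
  -- The zero polynomial has degree `0`, so the strict bound also needs the least common multiple to
  -- be nontrivial.
  have h0 : (0 : σ →₀ ℕ) ≺[ord] (a.1 ⊔ b.1) :=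
    lt_of_le_of_lt (by simp) (hab.trans_le (ord.toSyn_monotone le_sup_right))
  rw [MonomialOrder.degree_lt_iff h0]
  intro e he
  have h1 := (hasHead_genericPoly hr hfin hT a).monomial_mul hr (a.1 ⊔ b.1 - a.1)
  have h2 := (hasHead_genericPoly hr hfin hT b).monomial_mul hr (a.1 ⊔ b.1 - b.1)
  rw [tsub_add_cancel_of_le le_sup_left] at h1
  rw [tsub_add_cancel_of_le le_sup_right] at h2
  rw [mem_support_iff, genericSPoly, coeff_sub] at he
  by_cases hea : e = a.1 ⊔ b.1
  · rw [hea, h1.1, h2.1, sub_self] at he; exact absurd rfl he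
  · by_cases h3 : coeff e (monomial (a.1 ⊔ b.1 - a.1) 1 * genericPoly J T a) = 0
    · rw [h3, zero_sub, neg_ne_zero] at he
      exact hr.lt (h2.2 e hea he)
    · exact hr.lt (h1.2 e hea h3)

/-- On the stratum the remainder of the reduction specializes to zero. The quotients then express
the S-polynomial through multiples whose heads are bounded by its degree, which is below the least
common multiple because the leading terms cancel. The degrees are compared before specializing, over
the domain `k[C]`. -/
theorem map_sPoly_mem_belowSpan (hr : TailRel ord r) (hfin : ∀ a, (T a).Finite)
    (hT : ∀ a, ∀ b ∈ T a, r b a) (R : SReductions ord J T)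
    (θ : MvPolynomial (Params J T) k →+* A) (hθ : stratumIdeal R ≤ RingHom.ker θ)
    {a b : monBasis J} (hab : a.1 ≺[ord] b.1) :
    MvPolynomial.map θ (genericSPoly J T a b) ∈ belowSpan ord (fun c : monBasis J => c.1)
      (fun c => MvPolynomial.map θ (genericPoly J T c)) (a.1 ⊔ b.1) := by
  obtain ⟨g, hg, hdeg, -⟩ := R.isReduction a b hab
  have hH : MvPolynomial.map θ (R.H a b) = 0 := by
    ext e
    rw [coeff_map, coeff_zero, ← RingHom.mem_ker]
    exact hθ (Ideal.subset_span ⟨a, b, hab, e, rfl⟩)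
  have hlt := degree_genericSPoly_lt hr hfin hT hab
  rw [hg, map_add, hH, add_zero, Finsupp.linearCombination_apply, Finsupp.sum, map_sum]
  refine sum_mem fun c hc => ?_
  rw [smul_eq_mul, map_mul]
  have hc0 : g c ≠ 0 := Finsupp.mem_support_iff.1 hc
  have hF := hasHead_genericPoly hr hfin hT c
  have hF0 : genericPoly J T c ≠ 0 := by
    intro h0
    have := hF.1
    rw [h0] at this
    simp at this
  have hlt2 : (ord.degree (g c) + c.1) ≺[ord] (a.1 ⊔ b.1) := by
    refine lt_of_le_of_lt ?_ hlt
    have := hdeg c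
    rwa [MonomialOrder.degree_mul hF0 hc0, hF.degree_eq hr, add_comm] at this
  conv => enter [2]; rw [(g c).as_sum]
  rw [map_sum, Finset.sum_mul]
  refine sum_mem fun e he => ?_
  rw [map_monomial]
  have : monomial e (θ (coeff e (g c))) = θ (coeff e (g c)) • monomial e (1 : A) := by
    rw [smul_monomial, smul_eq_mul, mul_one]
  rw [this, smul_mul_assoc]
  refine Submodule.smul_mem _ _ (Submodule.subset_span ⟨e, c, ?_, rfl⟩)
  refine lt_of_le_of_lt ?_ hlt2
  rw [map_add, map_add]
  exact add_le_add_left (ord.le_degree he) _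

/-- A specialization of the parameters that lies on the stratum gives an ideal whose leading
monomials are those of `J`. -/
theorem leadIn_specIdeal [Finite σ] (hr : TailRel ord r) (hfin : ∀ a, (T a).Finite)
    (hT : ∀ a, ∀ b ∈ T a, r b a) (R : SReductions ord J T)
    (θ : MvPolynomial (Params J T) k →+* A) (hθ : stratumIdeal R ≤ RingHom.ker θ) :
    LeadIn ord (mons J) (specIdeal J T θ) := by
  have hM : mons J = {w | ∃ a : monBasis J, a.1 ≤ w} := by ext; exact mem_mons_iff
  rw [hM]
  refine leadIn_of_sPoly (fun a => ((hasHead_genericPoly hr hfin hT a).map θ).toLt hr) ?_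
  intro a b
  rcases lt_trichotomy (ord.toSyn a.1) (ord.toSyn b.1) with h | h | h
  · have := map_sPoly_mem_belowSpan hr hfin hT R θ hθ h
    rwa [map_genericSPoly] at this
  · have : a = b := Subtype.ext (ord.toSyn.injective h)
    rw [this, sub_self]
    exact zero_mem _
  · have := neg_mem (map_sPoly_mem_belowSpan hr hfin hT R θ hθ h)
    rwa [map_genericSPoly, neg_sub, sup_comm] at this

/-- A specialization whose polynomials lie in an ideal with leading monomials in `J` lies on
the stratum. -/
theorem stratumIdeal_le_ker [Finite σ] (R : SReductions ord J T)
    (θ : MvPolynomial (Params J T) k →+* A) {𝔞 : Ideal (MvPolynomial σ A)}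
    (h𝔞 : LeadIn ord (mons J) 𝔞)
    (h : ∀ a : monBasis J, MvPolynomial.map θ (genericPoly J T a) ∈ 𝔞) :
    stratumIdeal R ≤ RingHom.ker θ := by
  rw [stratumIdeal, Ideal.span_le]
  rintro _ ⟨a, b, hab, e, rfl⟩
  obtain ⟨g, hg, -, hsupp⟩ := R.isReduction a b hab
  have hH : MvPolynomial.map θ (R.H a b) = 0 := by
    refine h𝔞.eq_zero ?_ ?_
    · have h1 : R.H a b = genericSPoly J T a b - Finsupp.linearCombination _ (genericPoly J T) g := by
        rw [hg, add_sub_cancel_left]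
      rw [h1, map_sub, map_genericSPoly]
      refine sub_mem (sub_mem (𝔞.mul_mem_left _ (h a)) (𝔞.mul_mem_left _ (h b))) ?_
      rw [Finsupp.linearCombination_apply, Finsupp.sum, map_sum]
      refine sum_mem fun c _ => ?_
      rw [smul_eq_mul, map_mul]
      exact 𝔞.mul_mem_left _ (h c)
    · intro e he
      obtain ⟨c, hc⟩ := mem_mons_iff.1 he
      rw [coeff_map]
      by_cases h0 : e ∈ (R.H a b).support
      · exact absurd hc (hsupp e h0 c)
      · rw [notMem_support_iff.1 h0, map_zero]
  rw [SetLike.mem_coe, RingHom.mem_ker, ← coeff_map, hH, coeff_zero]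

end Stratum

/-! ### The torus action on the stratum -/

section Weights

variable {σ : Type}

/-- The inclusion of the exponents into the group of weights. -/
def wt : (σ →₀ ℕ) →+ (σ → ℤ) where
  toFun a i := a i
  map_zero' := by ext; simp
  map_add' a b := by ext; simp

theorem wt_injective : Function.Injective (wt : (σ →₀ ℕ) →+ (σ → ℤ)) := by
  intro a b h
  ext i
  have := congrFun h i
  simpa [wt] using this

end Weights

section Twist

variable {σ : Type} {ord : MonomialOrder.{0, v} σ} {A : Type*} [CommRing A]

/-- The rescaling of the monomials by a character. -/
def twist (χ : Multiplicative (σ →₀ ℕ) →* A) : MvPolynomial σ A →ₐ[A] MvPolynomial σ A :=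
  aeval fun i => C (χ (.ofAdd (Finsupp.single i 1))) * X i

theorem coeff_twist (χ : Multiplicative (σ →₀ ℕ) →* A) (p : MvPolynomial σ A) (e : σ →₀ ℕ) :
    (twist χ p).coeff e = χ (.ofAdd e) * p.coeff e := by
  classical
  have key : ∀ d : σ →₀ ℕ, (d.prod fun i n =>
      (C (χ (.ofAdd (Finsupp.single i 1))) * X i : MvPolynomial σ A) ^ n)
        = monomial d (χ (.ofAdd d)) := by
    intro d
    induction d using Finsupp.induction_linear with
    | zero => simp
    | add f g hf hg =>
      rw [Finsupp.prod_add_index' (by simp) (by intros; rw [pow_add]), hf, hg, monomial_mul, ofAdd_add,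
        map_mul χ]
    | single i n =>
      rw [Finsupp.prod_single_index (by simp), mul_pow, ← map_pow, ← map_pow, ← ofAdd_nsmul,
        Finsupp.smul_single, smul_eq_mul, mul_one, X_pow_eq_monomial, C_mul_monomial, mul_one]
  induction p using MvPolynomial.induction_on' with
  | monomial d c =>
    rw [twist, aeval_monomial, key, algebraMap_eq, C_mul_monomial, coeff_monomial, coeff_monomial]
    split_ifs with h
    · rw [h, mul_comm]
    · rw [mul_zero]
  | add p q hp hq => rw [map_add, coeff_add, hp, hq, coeff_add, mul_add]

/-- Rescaling each monomial by a unit preserves the support, hence the leading monomial. -/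
theorem LeadIn.comap_twist {M : Set (σ →₀ ℕ)} {𝔞 : Ideal (MvPolynomial σ A)} (h : LeadIn ord M 𝔞)
    (χ : Multiplicative (σ →₀ ℕ) →* A) (hχ : ∀ e, IsUnit (χ e)) :
    LeadIn ord M (𝔞.comap (twist χ)) := by
  intro p hp h0
  have hsupp : (twist χ p).support = p.support := by
    ext e
    rw [mem_support_iff, mem_support_iff, coeff_twist, Ne, (hχ _).mul_right_eq_zero]
  have h1 : twist χ p ≠ 0 := by
    rw [← support_nonempty, hsupp, support_nonempty]; exact h0
  have := h _ hp h1
  have hd : ord.degree (twist χ p) = ord.degree p := by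
    apply ord.toSyn.injective
    exact le_antisymm (ord.degree_le_degree_of_support_subset hsupp.subset)
      (ord.degree_le_degree_of_support_subset hsupp.superset)
  rwa [hd] at this

end Twist

section Coaction

variable {k : Type u} [Field k] {σ : Type} {ord : MonomialOrder.{0, v} σ}
  {r : (σ →₀ ℕ) → (σ →₀ ℕ) → Prop}
  {J : Ideal (MvPolynomial σ k)} {T : (σ →₀ ℕ) → Set (σ →₀ ℕ)}

/-- The coordinate ring of the stratum. -/
abbrev StratumRing (R : SReductions ord J T) : Type u := MvPolynomial (Params J T) k ⧸ stratumIdeal R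

/-- The coordinates on the stratum. -/
def stratumVar (R : SReductions ord J T) (c : Params J T) : StratumRing R :=
  Ideal.Quotient.mk _ (X c)

/-- The character with values in a group algebra. -/
def wtChar (σ : Type) (A : Type*) [CommRing A] :
    Multiplicative (σ →₀ ℕ) →* AddMonoidAlgebra A (σ → ℤ) where
  toFun e := AddMonoidAlgebra.single (wt e.toAdd) 1
  map_one' := by simp [AddMonoidAlgebra.one_def]
  map_mul' a b := by simp [AddMonoidAlgebra.single_mul_single]

theorem isUnit_wtChar (A : Type*) [CommRing A] (e : Multiplicative (σ →₀ ℕ)) :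
    IsUnit (wtChar σ A e) := by
  refine IsUnit.of_mul_eq_one (AddMonoidAlgebra.single (-wt e.toAdd) 1) ?_
  simp [wtChar, AddMonoidAlgebra.single_mul_single, AddMonoidAlgebra.one_def]

/-- Replacing `c_{a,b}` by `c_{a,b}` times the character `a - b` turns `F_a` into a rescaled copy of
itself, up to a unit. The rescaled ideal still has its leading monomials in `J`, so the new
coefficients again define a point of the stratum. -/
theorem map_coaction_eq_zero [Finite σ] (hr : TailRel ord r) (hfin : ∀ a, (T a).Finite)
    (hT : ∀ a, ∀ b ∈ T a, r b a) (R : SReductions ord J T) {B : Type*} [CommRing B] [Algebra k B]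
    (q : MvPolynomial (Params J T) k →ₐ[k] B) (hq : ∀ p ∈ stratumIdeal R, q p = 0)
    {p : MvPolynomial (Params J T) k} (hp : p ∈ stratumIdeal R) :
    aeval (fun c : Params J T =>
      (AddMonoidAlgebra.single (wt c.1.1 - wt c.2.1) (q (X c)) : AddMonoidAlgebra B (σ → ℤ))) p
      = 0 := by
  classical
  set Δ : MvPolynomial (Params J T) k →ₐ[k] AddMonoidAlgebra B (σ → ℤ) :=
    aeval fun c => AddMonoidAlgebra.single (wt c.1.1 - wt c.2.1) (q (X c)) with hΔ
  let θ : MvPolynomial (Params J T) k →+* AddMonoidAlgebra B (σ → ℤ) :=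
    AddMonoidAlgebra.singleZeroRingHom.comp (q : _ →+* B)
  have hθc : ∀ p, θ p = AddMonoidAlgebra.single 0 (q p) := fun _ => rfl
  have hθ : stratumIdeal R ≤ RingHom.ker θ := by
    intro p hp
    rw [RingHom.mem_ker, hθc, hq p hp, AddMonoidAlgebra.single_zero]
  have hL := (leadIn_specIdeal hr hfin hT R θ hθ).comap_twist (wtChar σ B) (isUnit_wtChar _)
  refine stratumIdeal_le_ker R (Δ : _ →+* AddMonoidAlgebra B (σ → ℤ)) hL (fun a => ?_) hp
  have ha : a.1 ∉ T a.1 := fun h => lt_irrefl _ (hr.lt (hT _ _ h))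
  have : twist (wtChar σ B) (MvPolynomial.map (Δ : _ →+* _) (genericPoly J T a)) =
      C (wtChar σ B (.ofAdd a.1)) * MvPolynomial.map θ (genericPoly J T a) := by
    ext1 e
    rw [coeff_twist, coeff_C_mul, coeff_map, coeff_map, coeff_genericPoly hfin a ha]
    by_cases he : e = a.1
    · simp only [he, if_true, map_one]
    · rw [if_neg he]
      by_cases hb : e ∈ T a.1
      · rw [dif_pos hb, hθc, RingHom.coe_coe, hΔ, aeval_X]
        change AddMonoidAlgebra.single _ _ * AddMonoidAlgebra.single _ _ =
          AddMonoidAlgebra.single _ _ * AddMonoidAlgebra.single _ _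
        rw [AddMonoidAlgebra.single_mul_single, AddMonoidAlgebra.single_mul_single]
        simp
      · rw [dif_neg hb, map_zero, map_zero, mul_zero, mul_zero]
  rw [Ideal.mem_comap, this]
  exact Ideal.mul_mem_left _ _ (Ideal.subset_span ⟨a, rfl⟩)

/-- The stratum is stable under the torus that rescales the variables. -/
theorem exists_coaction [Finite σ] (hr : TailRel ord r) (hfin : ∀ a, (T a).Finite)
    (hT : ∀ a, ∀ b ∈ T a, r b a) (R : SReductions ord J T) :
    ∃ ρ : StratumRing R →ₐ[k] AddMonoidAlgebra (StratumRing R) (σ → ℤ),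
      ∀ c : Params J T, ρ (stratumVar R c) =
        AddMonoidAlgebra.single (wt c.1.1 - wt c.2.1) (stratumVar R c) := by
  refine ⟨Ideal.Quotient.liftₐ (stratumIdeal R) _ (fun p hp => map_coaction_eq_zero hr hfin hT R
    (Ideal.Quotient.mkₐ k (stratumIdeal R)) (fun p hp => Ideal.Quotient.eq_zero_iff_mem.2 hp) hp),
    fun c => ?_⟩
  refine (Ideal.Quotient.liftₐ_apply _ _ _ _).trans ?_
  refine (Ideal.Quotient.lift_mk _ _ _).trans ?_
  refine (aeval_X _ _).trans ?_
  rfl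

end Coaction

/-! ### A graded Nakayama lemma -/

section Graded

variable {k : Type*} [Field k] {σ : Type} {ord : MonomialOrder.{0, v} σ} {B : Type*} [CommRing B]
  [Algebra k B] {ι C' : Type*}

theorem coaction_prod (ρ : B →ₐ[k] AddMonoidAlgebra B (σ → ℤ)) {x : C' → B} {α β : C' → σ →₀ ℕ}
    (hx : ∀ c, ρ (x c) = AddMonoidAlgebra.single (wt (α c) - wt (β c)) (x c)) (d : C' →₀ ℕ) :
    ρ (d.prod fun c n => x c ^ n) = AddMonoidAlgebra.single
      (wt (d.sum fun c n => n • α c) - wt (d.sum fun c n => n • β c)) (d.prod fun c n => x c ^ n) := by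
  classical
  induction d using Finsupp.induction_linear with
  | zero => simp [AddMonoidAlgebra.one_def]
  | add f g hf hg =>
    rw [Finsupp.prod_add_index' (by simp) (by intros; rw [pow_add]), map_mul, hf, hg,
      AddMonoidAlgebra.single_mul_single,
      Finsupp.sum_add_index' (by simp) (by intros; rw [add_smul]),
      Finsupp.sum_add_index' (by simp) (by intros; rw [add_smul]), map_add, map_add]
    congr 1
    abel
  | single c n =>
    rw [Finsupp.prod_single_index (by simp), Finsupp.sum_single_index (by simp),
      Finsupp.sum_single_index (by simp), map_pow, hx, AddMonoidAlgebra.single_pow, map_nsmul,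
      map_nsmul, smul_sub]

theorem sum_lt_sum_of_tails {α β : C' → σ →₀ ℕ} (hlt : ∀ c, β c ≺[ord] α c) {d : C' →₀ ℕ}
    (hd : d ≠ 0) :
    (d.sum fun c n => n • β c) ≺[ord] (d.sum fun c n => n • α c) := by
  rw [Finsupp.sum, Finsupp.sum, map_sum, map_sum]
  refine Finset.sum_lt_sum_of_nonempty (Finsupp.support_nonempty_iff.2 hd) fun c hc => ?_
  rw [map_nsmul, map_nsmul]
  exact nsmul_lt_nsmul_right (Finsupp.mem_support_iff.1 hc) (hlt c)

/-- A Nakayama lemma for algebras with a torus action for which the generators have positive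
weights. -/
theorem mem_adjoin_of_coaction [Finite C'] (ρ : B →ₐ[k] AddMonoidAlgebra B (σ → ℤ)) {x : C' → B}
    {α β : C' → σ →₀ ℕ} (hlt : ∀ c, β c ≺[ord] α c)
    (hx : ∀ c, ρ (x c) = AddMonoidAlgebra.single (wt (α c) - wt (β c)) (x c))
    {y : ι → B} {γ : ι → σ → ℤ} (hy : ∀ j, ρ (y j) = AddMonoidAlgebra.single (γ j) (y j))
    (h : ∀ c, x c ∈ Submodule.span k (insert 1 (Set.range y)) ⊔
      Submodule.span k {b | ∃ d : C' →₀ ℕ, 2 ≤ d.degree ∧ b = d.prod fun c n => x c ^ n}) (c : C') :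
    x c ∈ Algebra.adjoin k (Set.range y) := by
  classical
  -- Comparison of the weights `α - β`, written without subtraction. Finiteness of `C'` makes it
  -- well-founded.
  let rel : C' → C' → Prop := fun c₁ c₂ => (α c₁ + β c₂) ≺[ord] (α c₂ + β c₁)
  have htrans : IsTrans C' rel := by
    refine ⟨fun a b c h1 h2 => ?_⟩
    simp only [rel, map_add] at h1 h2 ⊢
    have h3 := add_lt_add h1 h2
    refine lt_of_add_lt_add_right (a := ord.toSyn (α b) + ord.toSyn (β b)) ?_
    calc _ = ord.toSyn (α a) + ord.toSyn (β b) + (ord.toSyn (α b) + ord.toSyn (β c)) := by abel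
      _ < _ := h3
      _ = _ := by abel
  have hirr : Std.Irrefl rel := ⟨fun a h => lt_irrefl _ h⟩
  have hwf : WellFounded rel := Finite.wellFounded_of_trans_of_irrefl rel
  induction c using hwf.induction with
  | _ c ih =>
  -- The component of the weight of `x c`. It fixes `x c`, and it either keeps or kills each `y j`
  -- and each product of generators.
  let π : B →ₗ[k] B :=
    { toFun := fun b => (ρ b).coeff (wt (α c) - wt (β c))
      map_add' := fun a b => by simp
      map_smul' := fun a b => by simp }
  have hπ : ∀ b, π b = (ρ b).coeff (wt (α c) - wt (β c)) := fun b => rfl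
  have hc : π (x c) = x c := by rw [hπ, hx, AddMonoidAlgebra.coeff_single, Finsupp.single_apply, if_pos rfl]
  obtain ⟨p, hp, q, hq, hpq⟩ := Submodule.mem_sup.1 (h c)
  rw [← hc, ← hpq, map_add]
  refine add_mem ?_ ?_
  · clear hpq
    induction hp using Submodule.span_induction with
    | mem b hb =>
      rcases hb with rfl | ⟨j, rfl⟩
      · rw [hπ, map_one, AddMonoidAlgebra.one_def, AddMonoidAlgebra.coeff_single, Finsupp.single_apply]
        split_ifs
        · exact one_mem _
        · exact zero_mem _
      · rw [hπ, hy, AddMonoidAlgebra.coeff_single, Finsupp.single_apply]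
        split_ifs
        · exact Algebra.subset_adjoin ⟨j, rfl⟩
        · exact zero_mem _
    | zero => rw [map_zero]; exact zero_mem _
    | add a b _ _ ha hb => rw [map_add]; exact add_mem ha hb
    | smul t a _ ha => rw [map_smul]; exact Subalgebra.smul_mem _ ha t
  · clear hpq
    induction hq using Submodule.span_induction with
    | mem b hb =>
      obtain ⟨d, hd, rfl⟩ := hb
      rw [hπ, coaction_prod ρ hx, AddMonoidAlgebra.coeff_single, Finsupp.single_apply]
      split_ifs with hw
      · rw [Finsupp.prod]
        refine prod_mem fun c₁ hc₁ => pow_mem (ih c₁ ?_) _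
        -- After one factor `x c₁` is split off, the rest is nonempty because the degree is at least
        -- two. It has positive weight, so `c₁` has smaller weight than `c` and the induction
        -- hypothesis covers it.
        have hd1 : d = Finsupp.single c₁ 1 + (d - Finsupp.single c₁ 1) := by
          rw [add_tsub_cancel_of_le]
          rw [Finsupp.single_le_iff]
          exact Nat.one_le_iff_ne_zero.2 (Finsupp.mem_support_iff.1 hc₁)
        set d' := d - Finsupp.single c₁ 1
        have hd' : d' ≠ 0 := by
          rintro h0
          rw [hd1, h0, add_zero, Finsupp.degree_single] at hd
          omega
        have hs := sum_lt_sum_of_tails hlt hd'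
        rw [hd1, Finsupp.sum_add_index' (by simp) (by intros; rw [add_smul]),
          Finsupp.sum_add_index' (by simp) (by intros; rw [add_smul]),
          Finsupp.sum_single_index (by simp), Finsupp.sum_single_index (by simp), one_smul, one_smul,
          sub_eq_sub_iff_add_eq_add, ← map_add, ← map_add] at hw
        have hw' := congrArg ord.toSyn (wt_injective hw)
        simp only [map_add] at hw'
        simp only [rel, map_add]
        refine lt_of_add_lt_add_right (a := ord.toSyn (d'.sum fun c n => n • β c)) ?_
        calc _ < ord.toSyn (α c₁) + ord.toSyn (β c) + ord.toSyn (d'.sum fun c n => n • α c) :=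
              add_lt_add_right hs _
          _ = _ := by rw [add_right_comm, hw']; abel
      · exact zero_mem _
    | zero => rw [map_zero]; exact zero_mem _
    | add a b _ _ ha hb => rw [map_add]; exact add_mem ha hb
    | smul t a _ ha => rw [map_smul]; exact Subalgebra.smul_mem _ ha t

end Graded

/-! ### Leading monomials of sums and products of ideals -/

section Product

variable {σ : Type} {ord : MonomialOrder.{0, v} σ} {r : (σ →₀ ℕ) → (σ →₀ ℕ) → Prop}
  {A : Type*} [CommRing A]

/-- In `b₀ + t g`, dividing `t` by the `F i` and moving the quotient part into the first summand
leaves `b₁ + N g` with `N` in normal form. If `N ≠ 0`, its leading monomial is outside `M`, and by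
`hM` that of `N g` is outside `M` as well, so it cannot cancel against the leading term of `b₁`. -/
theorem LeadIn.sup_span {M : Set (σ →₀ ℕ)} {n : σ →₀ ℕ} (hr : TailRel ord r)
    (hM : ∀ e, e + n ∈ M → e ∈ M) {ι : Type*} {a : ι → σ →₀ ℕ} {F : ι → MvPolynomial σ A}
    (hF : ∀ i, HasHead r (a i) (F i)) (ha : ∀ w, w ∈ M ↔ ∃ i, a i ≤ w)
    (hL : LeadIn ord M (Ideal.span (Set.range F))) {g : MvPolynomial σ A} (hg : HasHead r n g) :
    LeadIn ord (M ∪ {w | n ≤ w}) (Ideal.span (Set.range F) ⊔ Ideal.span {g}) := by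
  intro b hb h0
  have hA : Nontrivial A := by
    by_contra h
    rw [not_nontrivial_iff_subsingleton] at h
    exact h0 (Subsingleton.elim _ _)
  obtain ⟨b₀, hb₀, q, hq, rfl⟩ := Submodule.mem_sup.1 hb
  obtain ⟨t, rfl⟩ := Ideal.mem_span_singleton'.1 hq
  obtain ⟨c, N, htN, -, hN⟩ := ord.div
    (fun i => by rw [(hF i).leadingCoeff_eq hr]; exact isUnit_one : ∀ i, IsUnit (ord.leadingCoeff (F i))) t
  have hc : Finsupp.linearCombination (MvPolynomial σ A) F c ∈ Ideal.span (Set.range F) := by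
    rw [Finsupp.linearCombination_apply, Finsupp.sum]
    exact sum_mem fun i _ => Ideal.mul_mem_left _ _ (Ideal.subset_span ⟨i, rfl⟩)
  have hb₁ : b₀ + Finsupp.linearCombination (MvPolynomial σ A) F c * g ∈ Ideal.span (Set.range F) :=
    add_mem hb₀ (Ideal.mul_mem_right _ _ hc)
  have heq : b₀ + t * g = b₀ + Finsupp.linearCombination (MvPolynomial σ A) F c * g + N * g := by
    conv_lhs => rw [htN]
    ring
  rw [heq] at h0 ⊢
  generalize b₀ + Finsupp.linearCombination (MvPolynomial σ A) F c * g = b₁ at *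
  by_cases hN0 : N = 0
  · rw [hN0, zero_mul, add_zero] at h0 ⊢
    exact Or.inl (hL _ hb₁ h0)
  have hdN : ord.degree N ∉ M := by
    intro h
    obtain ⟨i, hi⟩ := (ha _).1 h
    exact hN _ (ord.degree_mem_support hN0) i (by rwa [(hF i).degree_eq hr])
  have hdg : ord.degree (N * g) = ord.degree N + n := by
    have h1 : ord.leadingCoeff g ∈ nonZeroDivisors A := by
      rw [hg.leadingCoeff_eq hr]; exact one_mem _
    rw [MonomialOrder.degree_mul_of_right_mem_nonZeroDivisors hN0 h1, hg.degree_eq hr]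
  by_cases hb10 : b₁ = 0
  · rw [hb10, zero_add, hdg]
    exact Or.inr (show n ≤ ord.degree N + n from le_add_left le_rfl)
  have hd1 := hL _ hb₁ hb10
  rcases lt_trichotomy (ord.toSyn (ord.degree b₁)) (ord.toSyn (ord.degree (N * g))) with h | h | h
  · rw [MonomialOrder.degree_add_eq_right_of_lt h, hdg]
    exact Or.inr (show n ≤ ord.degree N + n from le_add_left le_rfl)
  · have h' := ord.toSyn.injective h
    rw [h', hdg] at hd1
    exact absurd (hM _ hd1) hdN
  · rw [MonomialOrder.degree_add_of_lt h]
    exact Or.inl hd1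

theorem LeadIn.span_mul {M : Set (σ →₀ ℕ)} {m : σ →₀ ℕ} (hr : TailRel ord r)
    {𝔟 : Ideal (MvPolynomial σ A)} (h𝔟 : LeadIn ord M 𝔟) {f : MvPolynomial σ A} (hf : HasHead r m f) :
    LeadIn ord {w | ∃ κ ∈ M, w = m + κ} (Ideal.span {f} * 𝔟) := by
  intro b hb h0
  have hA : Nontrivial A := by
    by_contra h
    rw [not_nontrivial_iff_subsingleton] at h
    exact h0 (Subsingleton.elim _ _)
  obtain ⟨c, hc, rfl⟩ := Ideal.mem_span_singleton_mul.1 hb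
  have hc0 : c ≠ 0 := right_ne_zero_of_mul h0
  refine ⟨_, h𝔟 c hc hc0, ?_⟩
  have h1 : ord.leadingCoeff f ∈ nonZeroDivisors A := by
    rw [hf.leadingCoeff_eq hr]; exact one_mem _
  rw [MonomialOrder.degree_mul_of_left_mem_nonZeroDivisors h1 hc0, hf.degree_eq hr]

end Product

/-! ### Weighted homogeneous reduced bases -/

section Weighted

variable {k : Type*} [Field k] {σ : Type} {ord : MonomialOrder.{0, v} σ}
  {r : (σ →₀ ℕ) → (σ →₀ ℕ) → Prop} {A : Type*} [CommRing A] [Algebra k A]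

/-- The elements of weight `γ` for a torus action. -/
def wtPart (ρ : A →ₐ[k] AddMonoidAlgebra A (σ → ℤ)) (γ : σ → ℤ) : Submodule k A where
  carrier := {p | ρ p = AddMonoidAlgebra.single γ p}
  zero_mem' := by simp
  add_mem' {a b} ha hb := by
    simp only [Set.mem_ofPred_eq] at ha hb ⊢
    rw [map_add, ha, hb, AddMonoidAlgebra.single_add]
  smul_mem' t a ha := by
    simp only [Set.mem_ofPred_eq] at ha ⊢
    rw [map_smul, ha, AddMonoidAlgebra.smul_single]

theorem mem_wtPart {ρ : A →ₐ[k] AddMonoidAlgebra A (σ → ℤ)} {γ : σ → ℤ} {p : A} :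
    p ∈ wtPart ρ γ ↔ ρ p = AddMonoidAlgebra.single γ p := Iff.rfl

theorem mul_mem_wtPart {ρ : A →ₐ[k] AddMonoidAlgebra A (σ → ℤ)} {γ δ : σ → ℤ} {p q : A}
    (hp : p ∈ wtPart ρ γ) (hq : q ∈ wtPart ρ δ) : p * q ∈ wtPart ρ (γ + δ) := by
  rw [mem_wtPart] at *
  rw [map_mul, hp, hq, AddMonoidAlgebra.single_mul_single]

theorem one_mem_wtPart {ρ : A →ₐ[k] AddMonoidAlgebra A (σ → ℤ)} : (1 : A) ∈ wtPart ρ 0 := by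
  rw [mem_wtPart, map_one, AddMonoidAlgebra.one_def]

/-- `f` is homogeneous with the weight of `X^a` when the coefficients are given their weights. -/
def IsWtHom (ρ : A →ₐ[k] AddMonoidAlgebra A (σ → ℤ)) (a : σ →₀ ℕ) (f : MvPolynomial σ A) : Prop :=
  ∀ e, f.coeff e ∈ wtPart ρ (wt a - wt e)

theorem IsWtHom.mul {ρ : A →ₐ[k] AddMonoidAlgebra A (σ → ℤ)} {a b : σ →₀ ℕ} {f g : MvPolynomial σ A}
    (hf : IsWtHom ρ a f) (hg : IsWtHom ρ b g) : IsWtHom ρ (a + b) (f * g) := by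
  classical
  intro e
  rw [coeff_mul]
  refine sum_mem fun x hx => ?_
  rw [Finset.HasAntidiagonal.mem_antidiagonal] at hx
  have := mul_mem_wtPart (hf x.1) (hg x.2)
  rwa [sub_add_sub_comm, ← map_add, ← map_add, hx] at this

theorem isWtHom_monomial (ρ : A →ₐ[k] AddMonoidAlgebra A (σ → ℤ)) (a : σ →₀ ℕ) :
    IsWtHom ρ a (monomial a (1 : A)) := by
  classical
  intro e
  rw [coeff_monomial]
  split_ifs with h
  · rw [h, sub_self]; exact one_mem_wtPart
  · exact zero_mem _

/-- If every element of `M` is the head of an element of an ideal, then it is the head of an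
element of the ideal for which no other monomial lies in `M`. -/
theorem exists_reduced (hr : TailRel ord r) {M : Set (σ →₀ ℕ)} {𝔞 : Ideal (MvPolynomial σ A)}
    (ρ : A →ₐ[k] AddMonoidAlgebra A (σ → ℤ))
    (hE : ∀ w ∈ M, ∃ E ∈ 𝔞, HasHead r w E ∧ IsWtHom ρ w E) :
    ∀ w ∈ M, ∃ F ∈ 𝔞, HasHead r w F ∧ IsWtHom ρ w F ∧ ∀ e ∈ M, e ≠ w → F.coeff e = 0 := by
  classical
  suffices key : ∀ (s : ord.syn) (w : σ →₀ ℕ), ord.toSyn w = s → w ∈ M →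
      ∃ F ∈ 𝔞, HasHead r w F ∧ IsWtHom ρ w F ∧ ∀ e ∈ M, e ≠ w → F.coeff e = 0 from
    fun w hw => key _ w rfl hw
  intro s
  induction s using WellFoundedLT.induction with
  | ind s ih =>
  rintro w rfl hw
  obtain ⟨E, hEm, hEh, hEw⟩ := hE w hw
  -- The terms to be removed. Their monomials are smaller than `w`, so reduced elements with these
  -- heads exist by induction; subtracting such a multiple removes its own term and touches no other
  -- monomial of `M`.
  let D : Finset (σ →₀ ℕ) := E.support.filter fun e => e ∈ M ∧ e ≠ w
  have hD : ∀ e : D, e.1 ≠ w ∧ e.1 ∈ M ∧ r e.1 w := by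
    intro e
    obtain ⟨h1, h2, h3⟩ := Finset.mem_filter.1 e.2
    exact ⟨h3, h2, hEh.2 _ h3 (mem_support_iff.1 h1)⟩
  have hF : ∀ e : D, ∃ F ∈ 𝔞, HasHead r e.1 F ∧ IsWtHom ρ e.1 F ∧ ∀ e' ∈ M, e' ≠ e.1 → F.coeff e' = 0 :=
    fun e => ih _ (hr.lt (hD e).2.2) _ rfl (hD e).2.1
  choose F hFm hFh hFw hFr using hF
  have hco : ∀ d, (E - ∑ e : D, C (E.coeff e.1) * F e).coeff d =
      E.coeff d - ∑ e : D, E.coeff e.1 * (F e).coeff d := by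
    intro d
    rw [coeff_sub, coeff_sum]
    simp only [coeff_C_mul]
  have hrd : ∀ (e : D) d, E.coeff e.1 * (F e).coeff d ≠ 0 → r d w := by
    intro e d hne
    have h1 := right_ne_zero_of_mul hne
    by_cases hde : d = e.1
    · rw [hde]; exact (hD e).2.2
    · exact hr.trans ((hFh e).2 d hde h1) (hD e).2.2
  refine ⟨E - ∑ e : D, C (E.coeff e.1) * F e, sub_mem hEm (sum_mem fun e _ =>
    𝔞.mul_mem_left _ (hFm e)), ⟨?_, ?_⟩, ?_, ?_⟩
  · rw [hco, hEh.1, Finset.sum_eq_zero, sub_zero]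
    intro e _
    by_contra hne
    exact lt_irrefl _ (hr.lt (hrd e w hne))
  · intro d hd hne
    rw [hco] at hne
    by_cases h1 : E.coeff d = 0
    · rw [h1, zero_sub, neg_ne_zero] at hne
      obtain ⟨e, -, he⟩ := Finset.exists_ne_zero_of_sum_ne_zero hne
      exact hrd e d he
    · exact hEh.2 d hd h1
  · intro d
    rw [hco]
    refine sub_mem (hEw d) (sum_mem fun e _ => ?_)
    have := mul_mem_wtPart (hEw e.1) (hFw e d)
    rwa [sub_add_sub_cancel] at this
  · intro d hd hdw
    rw [hco]
    by_cases h1 : E.coeff d = 0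
    · rw [h1, Finset.sum_eq_zero, sub_zero]
      intro e _
      have : d ≠ e.1 := by
        rintro rfl
        exact mem_support_iff.1 (Finset.mem_filter.1 e.2).1 h1
      rw [hFr e d hd this, mul_zero]
    · have hdD : d ∈ D := Finset.mem_filter.2 ⟨mem_support_iff.2 h1, hd, hdw⟩
      rw [Finset.sum_eq_single ⟨d, hdD⟩]
      · rw [(hFh ⟨d, hdD⟩).1, mul_one, sub_self]
      · intro e _ he
        have : d ≠ e.1 := fun h => he (Subtype.ext h.symm)
        rw [hFr e d hd this, mul_zero]
      · simp

end Weighted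

/-! ### The factors `f`, `g` and the product family -/

section TailPoly

variable {σ : Type} {A B : Type*} [CommRing A] [CommRing B] {a : σ →₀ ℕ} {D : Set (σ →₀ ℕ)}

/-- `X^a` plus the combination of the monomials in `D` with coefficients `c`. -/
def tailPoly (a : σ →₀ ℕ) (D : Set (σ →₀ ℕ)) (c : D → A) : MvPolynomial σ A :=
  monomial a 1 + ∑ᶠ b : D, monomial b.1 (c b)

theorem coeff_tailPoly (hfin : D.Finite) (ha : a ∉ D) (c : D → A) (e : σ →₀ ℕ) :
    open Classical in (tailPoly a D c).coeff e =
      if e = a then 1 else if h : e ∈ D then c ⟨e, h⟩ else 0 := by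
  classical
  have := hfin.fintype
  rw [tailPoly, finsum_eq_sum_of_fintype, coeff_add, coeff_monomial, coeff_sum]
  simp only [coeff_monomial]
  by_cases he : e = a
  · rw [if_pos he.symm, if_pos he, Finset.sum_eq_zero, add_zero]
    intro b _
    rw [if_neg]
    rintro hb
    have hb2 : b.1 ∈ D := b.2
    rw [hb, he] at hb2
    exact ha hb2
  · rw [if_neg (Ne.symm he), if_neg he, zero_add]
    split_ifs with h
    · rw [Finset.sum_eq_single ⟨e, h⟩]
      · simp
      · intro b _ hb
        rw [if_neg]
        rintro rfl
        exact hb rfl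
      · simp
    · refine Finset.sum_eq_zero fun b _ => ?_
      rw [if_neg]
      rintro rfl
      exact h b.2

theorem hasHead_tailPoly {r : (σ →₀ ℕ) → (σ →₀ ℕ) → Prop} (hfin : D.Finite) (ha : a ∉ D)
    (hD : ∀ b ∈ D, r b a) (c : D → A) : HasHead r a (tailPoly a D c) := by
  classical
  constructor
  · rw [coeff_tailPoly hfin ha, if_pos rfl]
  · intro e he hc
    rw [coeff_tailPoly hfin ha, if_neg he] at hc
    by_cases h : e ∈ D
    · exact hD _ h
    · rw [dif_neg h] at hc; exact absurd rfl hc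

theorem map_tailPoly (hfin : D.Finite) (ha : a ∉ D) (c : D → A) (g : A →+* B) :
    MvPolynomial.map g (tailPoly a D c) = tailPoly a D (fun b => g (c b)) := by
  classical
  ext1 e
  rw [coeff_map, coeff_tailPoly hfin ha, coeff_tailPoly hfin ha]
  split_ifs <;> simp

theorem isWtHom_tailPoly {k : Type*} [Field k] [Algebra k A] (hfin : D.Finite) (ha : a ∉ D)
    {ρ : A →ₐ[k] AddMonoidAlgebra A (σ → ℤ)} {c : D → A}
    (hc : ∀ b, c b ∈ wtPart ρ (wt a - wt b.1)) : IsWtHom ρ a (tailPoly a D c) := by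
  classical
  intro e
  rw [coeff_tailPoly hfin ha]
  split_ifs with h1 h2
  · rw [h1, sub_self]; exact one_mem_wtPart
  · exact hc ⟨e, h2⟩
  · exact zero_mem _

end TailPoly

section Factorization

variable {k : Type u} [Field k] {σ : Type} [Finite σ] {ord : MonomialOrder.{0, v} σ}
  {r : (σ →₀ ℕ) → (σ →₀ ℕ) → Prop} {A : Type*} [CommRing A]
  {J₀ J : Ideal (MvPolynomial σ k)} {T₀ : (σ →₀ ℕ) → Set (σ →₀ ℕ)} {m n : σ →₀ ℕ}

/-- The ideal `f · ((F_u) + (g))`, where the `F_u` are specialized generic polynomials. -/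
def prodIdeal (J₀ : Ideal (MvPolynomial σ k)) (T₀ : (σ →₀ ℕ) → Set (σ →₀ ℕ))
    (θ : MvPolynomial (Params J₀ T₀) k →+* A) (f g : MvPolynomial σ A) : Ideal (MvPolynomial σ A) :=
  Ideal.span {f} * (specIdeal J₀ T₀ θ ⊔ Ideal.span {g})

theorem leadIn_prodIdeal (hr : TailRel ord r) (hfin : ∀ a, (T₀ a).Finite)
    (hT : ∀ a, ∀ b ∈ T₀ a, r b a) (R₀ : SReductions ord J₀ T₀)
    (hn : ∀ e, e + n ∈ mons J₀ → e ∈ mons J₀)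
    (hJ : ∀ w, w ∈ mons J ↔ ∃ κ ∈ mons J₀ ∪ {w | n ≤ w}, w = m + κ)
    (θ : MvPolynomial (Params J₀ T₀) k →+* A) (hθ : stratumIdeal R₀ ≤ RingHom.ker θ)
    {f g : MvPolynomial σ A} (hf : HasHead r m f) (hg : HasHead r n g) :
    LeadIn ord (mons J) (prodIdeal J₀ T₀ θ f g) := by
  have h1 := LeadIn.sup_span (M := mons J₀) hr hn
    (fun a => (hasHead_genericPoly hr hfin hT a).map θ) (fun w => mem_mons_iff)
    (leadIn_specIdeal hr hfin hT R₀ θ hθ) hg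
  have hM : mons J = {w | ∃ κ ∈ mons J₀ ∪ {w | n ≤ w}, w = m + κ} := by ext; exact hJ _
  rw [hM]
  exact h1.span_mul hr hf

/-- Multiply `f` by a monomial multiple of some `F_u` or of `g`. Homogeneity is carried along so
that the coefficients of the reduced basis become weight vectors. -/
theorem exists_head_prodIdeal [Algebra k A] (hr : TailRel ord r) (hfin : ∀ a, (T₀ a).Finite)
    (hT : ∀ a, ∀ b ∈ T₀ a, r b a)
    (hJ : ∀ w, w ∈ mons J ↔ ∃ κ ∈ mons J₀ ∪ {w | n ≤ w}, w = m + κ)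
    (ρ : A →ₐ[k] AddMonoidAlgebra A (σ → ℤ)) (θ : MvPolynomial (Params J₀ T₀) k →+* A)
    (hθ : ∀ c : Params J₀ T₀, θ (X c) ∈ wtPart ρ (wt c.1.1 - wt c.2.1))
    {f g : MvPolynomial σ A} (hf : HasHead r m f) (hg : HasHead r n g)
    (hf' : IsWtHom ρ m f) (hg' : IsWtHom ρ n g) :
    ∀ w ∈ mons J, ∃ E ∈ prodIdeal J₀ T₀ θ f g, HasHead r w E ∧ IsWtHom ρ w E := by
  classical
  intro w hw
  obtain ⟨κ, hκ, rfl⟩ := (hJ w).1 hw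
  suffices h : ∃ E ∈ specIdeal J₀ T₀ θ ⊔ Ideal.span {g}, HasHead r κ E ∧ IsWtHom ρ κ E by
    obtain ⟨E, hE, h1, h2⟩ := h
    exact ⟨f * E, Ideal.mul_mem_mul (Ideal.subset_span rfl) hE, hf.mul hr h1, hf'.mul h2⟩
  rcases hκ with h | h
  · obtain ⟨a, ha⟩ := mem_mons_iff.1 h
    have hw : IsWtHom ρ a.1 (MvPolynomial.map θ (genericPoly J₀ T₀ a)) := by
      intro e
      rw [coeff_map, coeff_genericPoly hfin a (fun h => lt_irrefl _ (hr.lt (hT _ _ h)))]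
      split_ifs with h1 h2
      · rw [h1, sub_self, map_one]; exact one_mem_wtPart
      · exact hθ ⟨a, ⟨e, h2⟩⟩
      · rw [map_zero]; exact zero_mem _
    have h1 := ((hasHead_genericPoly hr hfin hT a).map θ).monomial_mul hr (κ - a.1)
    have h2 := (isWtHom_monomial ρ (κ - a.1)).mul hw
    rw [tsub_add_cancel_of_le ha] at h1 h2
    exact ⟨_, Ideal.mul_mem_left _ _ (Ideal.mem_sup_left (Ideal.subset_span ⟨a, rfl⟩)), h1, h2⟩
  · have h1 := hg.monomial_mul hr (κ - n)
    have h2 := (isWtHom_monomial ρ (κ - n)).mul hg'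
    rw [tsub_add_cancel_of_le h] at h1 h2
    exact ⟨_, Ideal.mul_mem_left _ _ (Ideal.mem_sup_right (Ideal.subset_span rfl)), h1, h2⟩

end Factorization

/-! ### Tangent vectors at the origin and first order deformations -/

section TangentHom

variable {k : Type*} [Field k] {ι : Type*}

/-- The `k[ε]`-point of an affine space with base point the origin and tangent vector `t`. -/
def tangentHom (t : ι → k) : MvPolynomial ι k →ₐ[k] DualNumber k :=
  aeval fun c => TrivSqZeroExt.inr (t c)

theorem tangentHom_X (t : ι → k) (c : ι) : tangentHom t (X c) = TrivSqZeroExt.inr (t c) :=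
  aeval_X _ _

theorem fst_tangentHom (t : ι → k) (p : MvPolynomial ι k) :
    (tangentHom t p).fst = constantCoeff p := by
  induction p using MvPolynomial.induction_on with
  | C a => rw [← algebraMap_eq, AlgHom.commutes]; simp [TrivSqZeroExt.algebraMap_eq_inl]
  | add p q hp hq => rw [map_add, TrivSqZeroExt.fst_add, hp, hq, map_add]
  | mul_X p c hp => rw [map_mul, TrivSqZeroExt.fst_mul, tangentHom_X]; simp

theorem snd_tangentHom_mul_X (t : ι → k) (p : MvPolynomial ι k) (c : ι) :
    (tangentHom t (p * X c)).snd = constantCoeff p * t c := by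
  rw [map_mul, TrivSqZeroExt.snd_mul, tangentHom_X, fst_tangentHom]
  simp

theorem snd_tangentHom_C (t : ι → k) (a : k) : (tangentHom t (C a)).snd = 0 := by
  rw [← algebraMap_eq, AlgHom.commutes]; simp [TrivSqZeroExt.algebraMap_eq_inl]

/-- The derivative at the origin of a polynomial, as a function of the tangent vector. -/
def derivAt (p : MvPolynomial ι k) : (ι → k) →ₗ[k] k where
  toFun t := (tangentHom t p).snd
  map_add' t t' := by
    induction p using MvPolynomial.induction_on with
    | C a => simp only [snd_tangentHom_C, add_zero]
    | add p q hp hq => simp only [map_add, TrivSqZeroExt.snd_add, hp, hq]; ring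
    | mul_X p c hp => simp only [snd_tangentHom_mul_X, Pi.add_apply, mul_add]
  map_smul' a t := by
    induction p using MvPolynomial.induction_on with
    | C a => simp only [snd_tangentHom_C, smul_zero]
    | add p q hp hq => simp only [map_add, TrivSqZeroExt.snd_add, hp, hq]; simp; ring
    | mul_X p c hp => simp only [snd_tangentHom_mul_X, Pi.smul_apply, smul_eq_mul, RingHom.id_apply]; ring

theorem derivAt_apply (p : MvPolynomial ι k) (t : ι → k) : derivAt p t = (tangentHom t p).snd := rfl

end TangentHom

section Tangent

variable {k : Type u} [Field k] {σ : Type} {ord : MonomialOrder.{0, v} σ}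
  {r : (σ →₀ ℕ) → (σ →₀ ℕ) → Prop}
  {J : Ideal (MvPolynomial σ k)} {T : (σ →₀ ℕ) → Set (σ →₀ ℕ)}

/-- Subtracting the terms of `q` at monomials of `M` stays in the ideal and leaves a polynomial in
normal form, which must be zero. -/
theorem LeadIn.coeff_eq_zero {A : Type*} [CommRing A] {M : Set (σ →₀ ℕ)}
    {𝔞 : Ideal (MvPolynomial σ A)} (h : LeadIn ord M 𝔞) {q : MvPolynomial σ A} (hq : q ∈ 𝔞)
    (hM : ∀ e ∈ M, monomial e (q.coeff e) ∈ 𝔞) {e : σ →₀ ℕ} (he : e ∉ M) : q.coeff e = 0 := by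
  classical
  have hco : ∀ d, (q - ∑ e ∈ q.support.filter (· ∈ M), monomial e (q.coeff e)).coeff d =
      if d ∈ M then 0 else q.coeff d := by
    intro d
    rw [coeff_sub, coeff_sum]
    simp only [coeff_monomial]
    rw [Finset.sum_ite_eq']
    by_cases hd : d ∈ M
    · rw [if_pos hd]
      split_ifs with h1
      · exact sub_self _
      · rw [sub_zero]
        by_contra h2
        exact h1 (Finset.mem_filter.2 ⟨mem_support_iff.2 h2, hd⟩)
    · rw [if_neg hd, if_neg, sub_zero]
      exact fun h1 => hd (Finset.mem_filter.1 h1).2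
  have h0 := h.eq_zero (sub_mem hq (sum_mem fun e he => hM e (Finset.mem_filter.1 he).2))
    (fun d hd => by rw [hco, if_pos hd])
  have := hco e
  rw [if_neg he, h0, coeff_zero] at this
  exact this.symm

/-- The coordinate of `t` with given monomials, or zero if there is none. -/
def paramVal (t : Params J T → k) (a e : σ →₀ ℕ) : k :=
  open Classical in if h : ∃ _ : a ∈ monBasis J, e ∈ T a then t ⟨⟨a, h.1⟩, ⟨e, h.2⟩⟩ else 0

theorem paramVal_mk (t : Params J T → k) (c : Params J T) : paramVal t c.1.1 c.2.1 = t c := by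
  rw [paramVal, dif_pos ⟨c.1.2, c.2.2⟩]

theorem mem_of_paramVal_ne_zero {t : Params J T → k} {a e : σ →₀ ℕ} (h : paramVal t a e ≠ 0) :
    e ∈ T a := by
  by_contra h'
  exact h (by rw [paramVal, dif_neg]; exact fun h'' => h' h''.2)

/-- The coefficient of `X^e` in the first order part of the multiple of `F_a` with head `w`. -/
def shiftVal (t : Params J T → k) (a w e : σ →₀ ℕ) : k :=
  open Classical in if w - a ≤ e then paramVal t a (e - (w - a)) else 0

theorem rel_of_shiftVal_ne_zero (hr : TailRel ord r) (hT : ∀ a, ∀ b ∈ T a, r b a)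
    {t : Params J T → k} {a w e : σ →₀ ℕ} (haw : a ≤ w) (h : shiftVal t a w e ≠ 0) : r e w := by
  rw [shiftVal] at h
  split_ifs at h with h1
  · have h2 := (hr.add_iff (w - a)).2 (hT _ _ (mem_of_paramVal_ne_zero h))
    rwa [tsub_add_cancel_of_le h1, add_tsub_cancel_of_le haw] at h2
  · exact absurd rfl h

theorem coeff_map_tangentHom (hr : TailRel ord r) (hfin : ∀ a, (T a).Finite)
    (hT : ∀ a, ∀ b ∈ T a, r b a) (t : Params J T → k) (a : monBasis J) {w : σ →₀ ℕ} (haw : a.1 ≤ w)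
    (e : σ →₀ ℕ) : open Classical in
    (monomial (w - a.1) 1 * MvPolynomial.map (tangentHom t : _ →+* DualNumber k)
      (genericPoly J T a)).coeff e =
      (if e = w then 1 else 0) + TrivSqZeroExt.inr (shiftVal t a.1 w e) := by
  classical
  have ha : a.1 ∉ T a.1 := fun h => lt_irrefl _ (hr.lt (hT _ _ h))
  rw [coeff_monomial_mul', shiftVal]
  by_cases h : w - a.1 ≤ e
  · rw [if_pos h, if_pos h, one_mul, coeff_map, coeff_genericPoly hfin a ha]
    have he : e - (w - a.1) = a.1 ↔ e = w := by
      rw [tsub_eq_iff_eq_add_of_le h, add_tsub_cancel_of_le haw]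
    by_cases h1 : e = w
    · rw [if_pos (he.2 h1), if_pos h1, he.2 h1, paramVal, dif_neg (fun h => ha h.2)]
      simp
    · rw [if_neg (he.not.2 h1), if_neg h1, zero_add]
      by_cases h2 : e - (w - a.1) ∈ T a.1
      · rw [dif_pos h2, paramVal, dif_pos ⟨a.2, h2⟩]
        exact tangentHom_X _ _
      · rw [dif_neg h2, paramVal, dif_neg (fun h => h2 h.2)]
        simp
  · rw [if_neg h, if_neg h, if_neg]
    · simp
    · rintro rfl
      exact h tsub_le_self

/-- Since `ε² = 0`, multiplication by a multiple of `ε` erases the deformation. Hence the deformed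
ideal contains `ε` times every monomial of `J`, and first order terms matter only modulo `J`. -/
theorem inr_mul_monomial_mul (hr : TailRel ord r) (hfin : ∀ a, (T a).Finite)
    (hT : ∀ a, ∀ b ∈ T a, r b a) (t : Params J T → k) (a : monBasis J) {w : σ →₀ ℕ} (haw : a.1 ≤ w)
    (q : k) : (TrivSqZeroExt.inr q : DualNumber k) •
    (monomial (w - a.1) 1 * MvPolynomial.map (tangentHom t : _ →+* DualNumber k)
      (genericPoly J T a)) = monomial w (TrivSqZeroExt.inr q) := by
  classical
  ext1 e
  rw [coeff_smul, coeff_map_tangentHom hr hfin hT t a haw, coeff_monomial, smul_eq_mul, mul_add,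
    TrivSqZeroExt.inr_mul_inr, add_zero, mul_ite, mul_one, mul_zero]
  simp only [eq_comm]

/-- The origin lies on the stratum: there the `F_a` become the monomials `X^a`, and the ideal they
span has its leading monomials in `J`. -/
theorem constantCoeff_eq_zero [Finite σ] (hr : TailRel ord r) (hfin : ∀ a, (T a).Finite)
    (hT : ∀ a, ∀ b ∈ T a, r b a) (R : SReductions ord J T) {p : MvPolynomial (Params J T) k}
    (hp : p ∈ stratumIdeal R) : constantCoeff p = 0 := by
  classical
  have hL : LeadIn ord (mons J) (Ideal.span ((fun s => monomial s (1 : k)) '' monBasis J)) := by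
    intro b hb h0
    rw [mem_ideal_span_monomial_image] at hb
    obtain ⟨a, ha, hab⟩ := hb _ (ord.degree_mem_support h0)
    exact mons_upper ha.1 hab
  refine stratumIdeal_le_ker R constantCoeff hL (fun a => ?_) hp
  have ha : a.1 ∉ T a.1 := fun h => lt_irrefl _ (hr.lt (hT _ _ h))
  refine Ideal.subset_span ⟨a.1, a.2, ?_⟩
  ext1 e
  rw [coeff_map, coeff_genericPoly hfin a ha, coeff_monomial]
  by_cases h1 : e = a.1
  · rw [if_pos h1, if_pos h1.symm, map_one]
  · rw [if_neg h1, if_neg (Ne.symm h1)]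
    split_ifs <;> simp

/-- The tangent space of the stratum at the origin. -/
def tangentSpace (R : SReductions ord J T) : Submodule k (Params J T → k) :=
  ⨅ p : stratumIdeal R, LinearMap.ker (derivAt p.1)

theorem mem_tangentSpace {R : SReductions ord J T} {t : Params J T → k} :
    t ∈ tangentSpace R ↔ ∀ p ∈ stratumIdeal R, derivAt p t = 0 := by
  simp [tangentSpace, Submodule.mem_iInf]

theorem mem_tangentSpace_iff [Finite σ] (hr : TailRel ord r) (hfin : ∀ a, (T a).Finite)
    (hT : ∀ a, ∀ b ∈ T a, r b a) {R : SReductions ord J T} {t : Params J T → k} :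
    t ∈ tangentSpace R ↔ stratumIdeal R ≤ RingHom.ker (tangentHom t : _ →+* DualNumber k) := by
  rw [mem_tangentSpace]
  constructor
  · intro h p hp
    rw [RingHom.mem_ker]
    apply TrivSqZeroExt.ext
    · rw [RingHom.coe_coe, fst_tangentHom, constantCoeff_eq_zero hr hfin hT R hp]; simp
    · exact h p hp
  · intro h p hp
    have := h hp
    rw [RingHom.mem_ker, RingHom.coe_coe] at this
    rw [derivAt_apply, this, TrivSqZeroExt.snd_zero]

/-- Two multiples with the same head differ by a multiple of `ε` in the deformed ideal. Its terms in
`J` already belong to that ideal, so the remaining coefficients vanish. This is what makes the image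
of `X^w` well defined. -/
theorem shiftVal_eq_shiftVal [Finite σ] (hr : TailRel ord r) (hfin : ∀ a, (T a).Finite)
    (hT : ∀ a, ∀ b ∈ T a, r b a) {R : SReductions ord J T} {t : Params J T → k}
    (ht : t ∈ tangentSpace R) {a b : monBasis J} {w e : σ →₀ ℕ} (ha : a.1 ≤ w) (hb : b.1 ≤ w)
    (he : e ∉ mons J) : shiftVal t a.1 w e = shiftVal t b.1 w e := by
  classical
  have hL := leadIn_specIdeal hr hfin hT R _ ((mem_tangentSpace_iff hr hfin hT).1 ht)
  have hmem : ∀ c : monBasis J, MvPolynomial.map (tangentHom t : _ →+* DualNumber k)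
      (genericPoly J T c) ∈ specIdeal J T (tangentHom t : _ →+* DualNumber k) :=
    fun c => Ideal.subset_span ⟨c, rfl⟩
  have hco : ∀ e, (monomial (w - a.1) 1 * MvPolynomial.map (tangentHom t : _ →+* DualNumber k)
      (genericPoly J T a) - monomial (w - b.1) 1 * MvPolynomial.map
        (tangentHom t : _ →+* DualNumber k) (genericPoly J T b)).coeff e =
        TrivSqZeroExt.inr (shiftVal t a.1 w e - shiftVal t b.1 w e) := by
    intro e
    rw [coeff_sub, coeff_map_tangentHom hr hfin hT t a ha, coeff_map_tangentHom hr hfin hT t b hb,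
      add_sub_add_left_eq_sub, TrivSqZeroExt.inr_sub]
  have := hL.coeff_eq_zero (sub_mem (Ideal.mul_mem_left _ (monomial (w - a.1) 1) (hmem a))
    (Ideal.mul_mem_left _ (monomial (w - b.1) 1) (hmem b))) (fun d hd => ?_) he
  · rw [hco] at this
    have h2 := congrArg TrivSqZeroExt.snd this
    rwa [TrivSqZeroExt.snd_inr, TrivSqZeroExt.snd_zero, sub_eq_zero] at h2
  · obtain ⟨c, hc⟩ := mem_mons_iff.1 hd
    rw [hco, ← inr_mul_monomial_mul hr hfin hT t c hc, smul_eq_C_mul]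
    exact Ideal.mul_mem_left _ _ (Ideal.mul_mem_left _ _ (hmem c))

/-- A tangent vector of the stratum gives a homomorphism from the monomial ideal `J` to the quotient
modulo `J`; `Φ w e` is the coefficient of `X^e` in the image of `X^w`. -/
theorem exists_hom_of_mem_tangentSpace [Finite σ] (hr : TailRel ord r) (hfin : ∀ a, (T a).Finite)
    (hT : ∀ a, ∀ b ∈ T a, r b a) {R : SReductions ord J T} {t : Params J T → k}
    (ht : t ∈ tangentSpace R) : ∃ Φ : (σ →₀ ℕ) → (σ →₀ ℕ) → k,
      (∀ a ∈ monBasis J, ∀ e ∉ mons J, Φ a e = paramVal t a e) ∧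
      (∀ w ∈ mons J, ∀ e z, e + z ∉ mons J → Φ (w + z) (e + z) = Φ w e) ∧
      (∀ w ∈ mons J, ∀ e ∉ mons J, ∀ z, ¬ z ≤ e → Φ (w + z) e = 0) ∧
      (∀ w ∈ mons J, ∀ e, Φ w e ≠ 0 → r e w) := by
  classical
  let Φ : (σ →₀ ℕ) → (σ →₀ ℕ) → k := fun w e =>
    if h : ∃ a : monBasis J, a.1 ≤ w then shiftVal t h.choose.1 w e else 0
  have hΦ : ∀ (a : monBasis J) w e, a.1 ≤ w → e ∉ mons J → Φ w e = shiftVal t a.1 w e := by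
    intro a w e haw he
    have h : ∃ a : monBasis J, a.1 ≤ w := ⟨a, haw⟩
    simp only [Φ]
    rw [dif_pos h]
    exact shiftVal_eq_shiftVal hr hfin hT ht h.choose_spec haw he
  refine ⟨Φ, ?_, ?_, ?_, ?_⟩
  · intro a ha e he
    rw [hΦ ⟨a, ha⟩ a e le_rfl he, shiftVal, tsub_self, if_pos zero_le, tsub_zero]
  · intro w hw e z hez
    obtain ⟨a, ha⟩ := mem_mons_iff.1 hw
    have he : e ∉ mons J := fun h => hez (mons_upper h le_self_add)
    rw [hΦ a _ _ (ha.trans le_self_add) hez, hΦ a _ _ ha he, shiftVal, shiftVal,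
      tsub_add_eq_add_tsub ha |>.symm]
    simp only [add_le_add_iff_right]
    congr 1
    rw [add_tsub_add_eq_tsub_right]
  · intro w hw e he z hz
    obtain ⟨a, ha⟩ := mem_mons_iff.1 hw
    rw [hΦ a _ _ (ha.trans le_self_add) he, shiftVal, if_neg]
    intro h
    rw [← tsub_add_eq_add_tsub ha] at h
    exact hz (le_trans le_add_self h)
  · intro w hw e hne
    obtain ⟨a, ha⟩ := mem_mons_iff.1 hw
    have h : ∃ a : monBasis J, a.1 ≤ w := ⟨a, ha⟩
    simp only [Φ] at hne
    rw [dif_pos h] at hne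
    exact rel_of_shiftVal_ne_zero hr hT h.choose_spec hne

/-- By Buchberger's criterion, agreement at least common multiples suffices. The terms of the
S-polynomial in `J` are rewritten with the `F_c`, at heads smaller than the least common multiple.
-/
theorem mem_tangentSpace_of_shiftVal_eq [Finite σ] (hr : TailRel ord r) (hfin : ∀ a, (T a).Finite)
    (hT : ∀ a, ∀ b ∈ T a, r b a) (R : SReductions ord J T) {t : Params J T → k}
    (h : ∀ a b : monBasis J, ∀ e ∉ mons J,
      shiftVal t a.1 (a.1 ⊔ b.1) e = shiftVal t b.1 (a.1 ⊔ b.1) e) : t ∈ tangentSpace R := by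
  classical
  rw [mem_tangentSpace_iff hr hfin hT]
  have hL : LeadIn ord {w | ∃ a : monBasis J, a.1 ≤ w}
      (specIdeal J T (tangentHom t : _ →+* DualNumber k)) := by
    refine leadIn_of_sPoly
      (fun a => ((hasHead_genericPoly hr hfin hT a).map _).toLt hr) (fun a b => ?_)
    have hco : ∀ e, (monomial (a.1 ⊔ b.1 - a.1) 1 * MvPolynomial.map
        (tangentHom t : _ →+* DualNumber k) (genericPoly J T a) -
        monomial (a.1 ⊔ b.1 - b.1) 1 * MvPolynomial.map
        (tangentHom t : _ →+* DualNumber k) (genericPoly J T b)).coeff e =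
        TrivSqZeroExt.inr (shiftVal t a.1 (a.1 ⊔ b.1) e - shiftVal t b.1 (a.1 ⊔ b.1) e) := by
      intro e
      rw [coeff_sub, coeff_map_tangentHom hr hfin hT t a le_sup_left,
        coeff_map_tangentHom hr hfin hT t b le_sup_right,
        add_sub_add_left_eq_sub, TrivSqZeroExt.inr_sub]
    generalize monomial (a.1 ⊔ b.1 - a.1) 1 * MvPolynomial.map
        (tangentHom t : _ →+* DualNumber k) (genericPoly J T a) -
        monomial (a.1 ⊔ b.1 - b.1) 1 * MvPolynomial.map
        (tangentHom t : _ →+* DualNumber k) (genericPoly J T b) = Q at hco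
    rw [Q.as_sum]
    refine sum_mem fun e he => ?_
    rw [mem_support_iff, hco] at he
    rw [hco]
    have hne : shiftVal t a.1 (a.1 ⊔ b.1) e - shiftVal t b.1 (a.1 ⊔ b.1) e ≠ 0 := by
      intro h0; rw [h0] at he; simp at he
    have heJ : e ∈ mons J := by
      by_contra h0; exact hne (sub_eq_zero.2 (h a b e h0))
    obtain ⟨c, hc⟩ := mem_mons_iff.1 heJ
    rw [← inr_mul_monomial_mul hr hfin hT t c hc]
    refine Submodule.smul_mem _ _ (Submodule.subset_span ⟨e - c.1, c, ?_, rfl⟩)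
    rw [tsub_add_cancel_of_le hc]
    apply hr.lt
    by_cases h1 : shiftVal t a.1 (a.1 ⊔ b.1) e = 0
    · rw [h1, zero_sub, neg_ne_zero] at hne
      exact rel_of_shiftVal_ne_zero hr hT le_sup_right hne
    · exact rel_of_shiftVal_ne_zero hr hT le_sup_left h1
  have hM : mons J = {w | ∃ a : monBasis J, a.1 ≤ w} := by ext; exact mem_mons_iff
  rw [← hM] at hL
  exact stratumIdeal_le_ker R _ hL fun a => Ideal.subset_span ⟨a, rfl⟩

end Tangent

/-! ### The part of a homomorphism not divisible by the common factor -/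

section CommonFactor

variable {X Y : Type} {k : Type*} [Field k]

/-- Let `K = M₀ ∪ (n)` where `M₀` is generated by monomials in `X` and `n` is a monomial in `Y`, and
let `m` be a monomial in `Y`. The part of a homomorphism `mK → k[X,Y] / mK` that is not divisible by
`m` is the multiplication by a polynomial `h` followed by division by `m`. -/
theorem exists_common_factor {S M₀ J : Set (X ⊕ Y →₀ ℕ)} {m n : X ⊕ Y →₀ ℕ} (hS : S.Nonempty)
    (hSX : ∀ s ∈ S, ∀ y, s (Sum.inr y) = 0) (hM₀ : ∀ e, e ∈ M₀ ↔ ∃ s ∈ S, s ≤ e)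
    (hm : ∀ x, m (Sum.inl x) = 0) (hn : ∀ x, n (Sum.inl x) = 0)
    (hJ : ∀ w, w ∈ J ↔ ∃ κ ∈ M₀ ∪ {w | n ≤ w}, w = m + κ)
    {Φ : (X ⊕ Y →₀ ℕ) → (X ⊕ Y →₀ ℕ) → k}
    (hadd : ∀ w ∈ M₀ ∪ {w | n ≤ w}, ∀ e z, e + z ∉ J → Φ (w + z) (e + z) = Φ w e)
    (hzero : ∀ w ∈ M₀ ∪ {w | n ≤ w}, ∀ e ∉ J, ∀ z, ¬ z ≤ e → Φ (w + z) e = 0) :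
    ∃ h : (X ⊕ Y →₀ ℕ) → k, (∀ b, h b ≠ 0 → ∃ s ∈ M₀, Φ s (b + s) ≠ 0) ∧
      ∀ w ∈ M₀ ∪ {w | n ≤ w}, ∀ e, ¬ m ≤ e →
        open Classical in Φ w e = if w ≤ e then h (e - w) else 0 := by
  classical
  obtain ⟨s, hs⟩ := hS
  have hSM : ∀ s ∈ S, s ∈ M₀ ∪ {w | n ≤ w} := fun s hs => Or.inl ((hM₀ s).2 ⟨s, hs, le_rfl⟩)
  have hnJ : ∀ e v, e v < m v → e ∉ J := by
    intro e v hv he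
    obtain ⟨κ, -, rfl⟩ := (hJ e).1 he
    rw [Finsupp.add_apply] at hv
    omega
  have hexv : ∀ e, ¬ m ≤ e → ∃ y, e (Sum.inr y) < m (Sum.inr y) := by
    intro e he
    rw [Finsupp.le_def] at he
    push Not at he
    obtain ⟨v, hv⟩ := he
    rcases v with x | y
    · rw [hm x] at hv; omega
    · exact ⟨y, hv⟩
  -- `h` is the quotient of the image of one fixed generator `s` by `X^s`. Multiplying by `s`, a
  -- monomial in `X`, never makes a monomial divisible by `m`, so comparing the images of `s` and
  -- `w` through that of `w + s` loses nothing.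
  refine ⟨fun b => if m ≤ b then 0 else Φ s (b + s), ?_, ?_⟩
  · intro b hb
    dsimp only at hb
    split_ifs at hb with h
    · exact absurd rfl hb
    · exact ⟨s, (hM₀ s).2 ⟨s, hs, le_rfl⟩, hb⟩
  intro w hw e he
  obtain ⟨y, hy⟩ := hexv e he
  have hsy := hSX s hs y
  have hes : e + s ∉ J := hnJ _ (Sum.inr y) (by rw [Finsupp.add_apply, hsy]; omega)
  have h1 : Φ (w + s) (e + s) = Φ w e := hadd w hw e s hes
  by_cases hwe : w ≤ e
  · have hme : ¬ m ≤ e - w := fun h => he (h.trans tsub_le_self)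
    dsimp only
    rw [if_pos hwe, if_neg hme, ← h1, add_comm w s]
    have h2 : e + s = (e - w + s) + w := by rw [add_right_comm, tsub_add_cancel_of_le hwe]
    rw [h2] at hes ⊢
    exact hadd s (hSM s hs) _ w hes
  rw [if_neg hwe]
  by_contra hne
  rw [← h1] at hne
  have hwes : w ≤ e + s := by
    by_contra h
    exact hne (by rw [add_comm w s]; exact hzero s (hSM s hs) _ hes w h)
  obtain ⟨x, hx⟩ : ∃ x, e (Sum.inl x) < w (Sum.inl x) := by
    rw [Finsupp.le_def] at hwe
    push Not at hwe
    obtain ⟨v, hv⟩ := hwe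
    rcases v with x | y'
    · exact ⟨x, hv⟩
    · have := hwes (Sum.inr y')
      rw [Finsupp.add_apply, hSX s hs y'] at this
      omega
  obtain ⟨d, hd⟩ : ∃ d, e + s = d + w := ⟨e + s - w, (tsub_add_cancel_of_le hwes).symm⟩
  have hdv : ∀ v, e v + s v = d v + w v := fun v => by
    rw [← Finsupp.add_apply, hd, Finsupp.add_apply]
  have h2 : Φ s d ≠ 0 := by
    rw [← hadd s (hSM s hs) d w (by rwa [← hd]), ← hd, add_comm s w]
    exact hne
  -- If `w` does not divide `e`, it fails to do so at a variable `x` of `X`, and the image of `s`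
  -- contains a monomial with smaller `x`-exponent than `s`. The defect is transferred to a
  -- generator `s'` whose `x`-exponent is minimal in `S`.
  obtain ⟨s', hs', hmin⟩ := (measure fun s : X ⊕ Y →₀ ℕ => s (Sum.inl x)).wf.has_min S ⟨s, hs⟩
  have hmin' : ∀ t ∈ S, s' (Sum.inl x) ≤ t (Sum.inl x) := fun t ht => not_lt.1 (hmin t ht)
  have hdy := hdv (Sum.inr y)
  have hs'y := hSX s' hs' y
  have h3 : d + s' ∉ J := hnJ _ (Sum.inr y) (by rw [Finsupp.add_apply]; omega)
  have h4 : Φ (s' + s) (d + s') ≠ 0 := by rwa [add_comm s' s, hadd s (hSM s hs) d s' h3]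
  have h5 : s ≤ d + s' := by
    by_contra h
    exact h4 (hzero s' (hSM s' hs') _ h3 s h)
  obtain ⟨d', hd'⟩ : ∃ d', d + s' = d' + s := ⟨d + s' - s, (tsub_add_cancel_of_le h5).symm⟩
  have hdv' : ∀ v, d v + s' v = d' v + s v := fun v => by
    rw [← Finsupp.add_apply, hd', Finsupp.add_apply]
  have h6 : Φ s' d' ≠ 0 := by
    rw [hd'] at h3 h4
    rwa [hadd s' (hSM s' hs') d' s h3] at h4
  have hx1 := hdv (Sum.inl x)
  have hx2 := hdv' (Sum.inl x)
  have hy2 := hdv' (Sum.inr y)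
  -- Multiplication by `n` completes the contradiction: `d' + n` is outside `J`, by minimality of
  -- `s'` at `x` and because `d'` is below `m` at `y`. Yet it would occur in the image of `s' + n`,
  -- hence be divisible by `s'`, although its `x`-exponent is too small.
  have h7 : d' + n ∉ J := by
    intro h
    obtain ⟨κ, hκ, heq⟩ := (hJ _).1 h
    have hev : ∀ v, d' v + n v = m v + κ v := fun v => by
      rw [← Finsupp.add_apply, heq, Finsupp.add_apply]
    rcases hκ with hκ | hκ
    · obtain ⟨t, ht, htκ⟩ := (hM₀ κ).1 hκ
      have e1 := htκ (Sum.inl x)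
      have e2 := hmin' t ht
      have e3 := hev (Sum.inl x)
      rw [hn x] at e3
      omega
    · have e1 : n ≤ κ := hκ
      have e2 := e1 (Sum.inr y)
      have e3 := hev (Sum.inr y)
      omega
  have h8 := hadd s' (hSM s' hs') d' n h7
  rw [add_comm s' n] at h8
  refine h6 (h8 ▸ hzero n (Or.inr (show n ≤ n from le_rfl)) _ h7 s' fun h => ?_)
  have := h (Sum.inl x)
  rw [Finsupp.add_apply, hn x] at this
  omega

end CommonFactor

/-! ### The tangent space of the product -/

section Decomposition

variable {k : Type u} [Field k] {X Y : Type} {ord : MonomialOrder.{0, v} (X ⊕ Y)}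
  {r : (X ⊕ Y →₀ ℕ) → (X ⊕ Y →₀ ℕ) → Prop} {J₀ J : Ideal (MvPolynomial (X ⊕ Y) k)}
  {T₀ T : (X ⊕ Y →₀ ℕ) → Set (X ⊕ Y →₀ ℕ)} {m n : X ⊕ Y →₀ ℕ}

/-- Extension of a function by zero. -/
def extZero {α : Type*} {D : Set α} (c : D → k) (e : α) : k :=
  open Classical in if h : e ∈ D then c ⟨e, h⟩ else 0

theorem extZero_of_support {α : Type*} {D : Set α} {f : α → k} (hf : ∀ e, f e ≠ 0 → e ∈ D) (e : α) :
    extZero (fun b : D => f b.1) e = f e := by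
  classical
  rw [extZero]
  split_ifs with h
  · rfl
  · by_contra h0
    exact h (hf e (Ne.symm h0))

/-- The tangent vector at the origin of a product of a polynomial with head `m` and an ideal whose
initial ideal is generated by `J₀` and `X^n`. -/
def productTangent (J₀ J : Ideal (MvPolynomial (X ⊕ Y) k)) (T₀ T : (X ⊕ Y →₀ ℕ) → Set (X ⊕ Y →₀ ℕ))
    (m n : X ⊕ Y →₀ ℕ) (D₁ D₂ : Set (X ⊕ Y →₀ ℕ)) :
    ((D₁ → k) × (D₂ → k)) × (Params J₀ T₀ → k) →ₗ[k] (Params J T → k) :=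
  open Classical in
  { toFun := fun p c =>
      (if c.1.1 - m ≤ c.2.1 then extZero p.1.1 (c.2.1 - (c.1.1 - m)) else 0) +
      (if m ≤ c.2.1 then
        (if c.1.1 - m = n then extZero p.1.2 (c.2.1 - m) else
          paramVal p.2 (c.1.1 - m) (c.2.1 - m)) else 0)
    map_add' := fun p q => by
      ext c
      simp only [extZero, paramVal, Pi.add_apply, Prod.fst_add, Prod.snd_add]
      split_ifs <;> ring
    map_smul' := fun a p => by
      ext c
      simp only [extZero, paramVal, Pi.smul_apply, Prod.smul_fst, Prod.smul_snd, RingHom.id_apply,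
        smul_eq_mul]
      split_ifs <;> ring }

/-- Removing the common multiplier `h`, which deforms `f`, and dividing by `m` leaves a homomorphism
`Ψ` from `K` to the quotient by `K`. Its value at `n` deforms `g`, and its values on the basis of
`J₀` form a tangent vector of `St(J₀/(n₀))`. This bounds the dimension of the tangent space. -/
theorem exists_productTangent_eq [Finite X] [Finite Y] (hr : TailRel ord r)
    (hfin₀ : ∀ a, (T₀ a).Finite) (hfin : ∀ a, (T a).Finite)
    (hT₀ : ∀ a e, e ∈ T₀ a ↔ r e a ∧ e ∉ mons J₀ ∧ ¬ n ≤ e)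
    (hT : ∀ a e, e ∈ T a ↔ r e a ∧ e ∉ mons J)
    {S : Set (X ⊕ Y →₀ ℕ)} (hS : S.Nonempty)
    (hSX : ∀ s ∈ S, ∀ y, s (Sum.inr y) = 0) (hM₀ : ∀ e, e ∈ mons J₀ ↔ ∃ s ∈ S, s ≤ e)
    (hm : ∀ x, m (Sum.inl x) = 0) (hn : ∀ x, n (Sum.inl x) = 0)
    (hJ : ∀ w, w ∈ mons J ↔ ∃ κ ∈ mons J₀ ∪ {w | n ≤ w}, w = m + κ)
    (R₀ : SReductions ord J₀ T₀) (R : SReductions ord J T)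
    {t : Params J T → k} (ht : t ∈ tangentSpace R) :
    ∃ p : ({b | r b m} → k) × ({b | r b n ∧ b ∉ mons J₀} → k), ∃ t₀ ∈ tangentSpace R₀,
      productTangent J₀ J T₀ T m n _ _ (p, t₀) = t := by
  classical
  have hT' : ∀ a, ∀ b ∈ T a, r b a := fun a b h => ((hT a b).1 h).1
  have hT₀' : ∀ a, ∀ b ∈ T₀ a, r b a := fun a b h => ((hT₀ a b).1 h).1
  obtain ⟨Φ, hbas, hadd, hzero, hrel⟩ := exists_hom_of_mem_tangentSpace hr hfin hT' ht
  set K : Set (X ⊕ Y →₀ ℕ) := mons J₀ ∪ {w | n ≤ w} with hK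
  have hmK : ∀ κ ∈ K, m + κ ∈ mons J := fun κ hκ => (hJ _).2 ⟨κ, hκ, rfl⟩
  have hKm : ∀ κ, m + κ ∈ mons J → κ ∈ K := by
    intro κ h
    obtain ⟨κ', h', heq⟩ := (hJ _).1 h
    rwa [add_left_cancel heq]
  have hKup : ∀ w z, w ∈ K → w + z ∈ K := by
    rintro w z (h | h)
    · exact Or.inl (mons_upper h le_self_add)
    · exact Or.inr (le_trans (show n ≤ w from h) le_self_add)
  obtain ⟨h, hhne, hheq⟩ := exists_common_factor (J := mons J) hS hSX hM₀ hm hn hJ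
    (Φ := fun w e => Φ (m + w) e)
    (fun w hw e z hez => by rw [← add_assoc]; exact hadd _ (hmK w hw) e z hez)
    (fun w hw e he z hz => by rw [← add_assoc]; exact hzero _ (hmK w hw) e he z hz)
  have hhr : ∀ b, h b ≠ 0 → r b m := by
    intro b hb
    obtain ⟨s, hs, hne⟩ := hhne b hb
    exact (hr.add_iff s).1 (hrel _ (hmK s (Or.inl hs)) _ hne)
  -- the part that is divisible by `m`
  let Ψ : (X ⊕ Y →₀ ℕ) → (X ⊕ Y →₀ ℕ) → k := fun w e =>
    Φ (m + w) (m + e) - if w ≤ m + e then h (m + e - w) else 0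
  have hΨadd : ∀ w ∈ K, ∀ e z, e + z ∉ K → Ψ (w + z) (e + z) = Ψ w e := by
    intro w hw e z hez
    have h1 : (m + e) + z ∉ mons J := fun h => hez (hKm _ (by rwa [← add_assoc]))
    simp only [Ψ]
    rw [← add_assoc, ← add_assoc, hadd _ (hmK w hw) _ z h1, add_tsub_add_eq_tsub_right]
    simp only [add_le_add_iff_right]
  have hΨzero : ∀ w ∈ K, ∀ e ∉ K, ∀ z, ¬ z ≤ e → Ψ (w + z) e = 0 := by
    intro w hw e he z hz
    have h1 : m + e ∉ mons J := fun h => he (hKm _ h)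
    simp only [Ψ]
    -- If `z` divides `m + e` but not `e`, the quotient `q` is not divisible by `m`. There `Φ`
    -- equals the contribution of `h`, so the difference vanishes.
    by_cases hzm : z ≤ m + e
    · obtain ⟨q, hq⟩ : ∃ q, m + e = q + z := ⟨m + e - z, (tsub_add_cancel_of_le hzm).symm⟩
      have hmq : ¬ m ≤ q := by
        intro hmq
        apply hz
        obtain ⟨q', rfl⟩ := le_iff_exists_add.1 hmq
        rw [add_assoc] at hq
        rw [add_left_cancel hq]
        exact le_add_self
      rw [hq, ← add_assoc, hadd _ (hmK w hw) _ z (by rwa [← hq]), hheq w hw q hmq,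
        add_tsub_add_eq_tsub_right]
      simp only [add_le_add_iff_right, sub_self]
    · rw [← add_assoc, hzero _ (hmK w hw) _ h1 z hzm, if_neg, sub_zero]
      exact fun h => hzm (le_trans le_add_self h)
  have hΨrel : ∀ w ∈ K, ∀ e, Ψ w e ≠ 0 → r e w := by
    intro w hw e hne
    rw [← hr.add_iff m, add_comm e, add_comm w]
    by_cases h1 : Φ (m + w) (m + e) = 0
    · simp only [Ψ] at hne
      rw [h1, zero_sub, neg_ne_zero] at hne
      split_ifs at hne with h2
      · have := (hr.add_iff w).2 (hhr _ hne)
        rwa [tsub_add_cancel_of_le h2] at this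
      · exact absurd rfl hne
    · exact hrel _ (hmK w hw) _ h1
  let t₀ : Params J₀ T₀ → k := fun c => Ψ c.1.1 c.2.1
  have ht₀ : ∀ u ∈ monBasis J₀, ∀ e ∉ K, paramVal t₀ u e = Ψ u e := by
    intro u hu e he
    rw [paramVal]
    split_ifs with h1
    · rfl
    · by_contra hne
      refine h1 ⟨hu, (hT₀ _ _).2 ⟨hΨrel u (Or.inl hu.1) e (Ne.symm hne), fun h => he (Or.inl h),
        fun h => he (Or.inr h)⟩⟩
  have hbasX : ∀ u ∈ monBasis J₀, ∀ y, u (Sum.inr y) = 0 := by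
    intro u hu y
    obtain ⟨s, hs, hsu⟩ := (hM₀ u).1 hu.1
    have hle := hu.2 ((hM₀ s).2 ⟨s, hs, le_rfl⟩) hsu (Sum.inr y)
    rw [hSX s hs y] at hle
    exact Nat.le_zero.1 hle
  have hshift : ∀ u ∈ monBasis J₀, ∀ w, u ≤ w → (∀ y, w (Sum.inr y) = 0) → ∀ e ∉ mons J₀,
      shiftVal t₀ u w e = if n ≤ e then 0 else Ψ w e := by
    intro u hu w huw hwX e he
    have hz : u + (w - u) = w := add_tsub_cancel_of_le huw
    -- Let `n` divide `e`. As `w` has no variable in `Y`, `n` also divides the shifted monomial,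
    -- which `T₀` excludes. So all shifts vanish here, although `Ψ` is controlled only outside `K`.
    split_ifs with hne
    · by_contra h0
      rw [shiftVal] at h0
      split_ifs at h0 with h1
      · have h2 := (hT₀ _ _).1 (mem_of_paramVal_ne_zero h0)
        refine h2.2.2 fun i => ?_
        rcases i with x | y
        · rw [hn]
          exact Nat.zero_le _
        · rw [Finsupp.tsub_apply, Finsupp.tsub_apply, hwX y, Nat.zero_sub, tsub_zero]
          exact hne _
      · exact h0 rfl
    · have heK : e ∉ K := by rintro (h | h); exacts [he h, hne h]
      rw [shiftVal]
      split_ifs with h1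
      · have h2 : e - (w - u) ∉ K := fun h => heK (by
          have := hKup _ (w - u) h
          rwa [tsub_add_cancel_of_le h1] at this)
        rw [ht₀ u hu _ h2, ← hΨadd u (Or.inl hu.1) _ (w - u) (by rwa [tsub_add_cancel_of_le h1]),
          tsub_add_cancel_of_le h1, hz]
      · rw [← hΨzero u (Or.inl hu.1) e heK _ h1, hz]
  refine ⟨(fun b => h b.1, fun b => Ψ n b.1), t₀, ?_, ?_⟩
  · refine mem_tangentSpace_of_shiftVal_eq hr hfin₀ hT₀' R₀ fun a b e he => ?_
    have hX : ∀ y, (a.1 ⊔ b.1) (Sum.inr y) = 0 := by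
      intro y
      rw [Finsupp.sup_apply, hbasX _ a.2, hbasX _ b.2, sup_idem]
    rw [hshift a.1 a.2 _ le_sup_left hX e he, hshift b.1 b.2 _ le_sup_right hX e he]
  · ext c
    obtain ⟨⟨a, ha⟩, ⟨e, he⟩⟩ := c
    have heT := (hT _ _).1 he
    obtain ⟨κ, hκ, rfl⟩ := (hJ a).1 ha.1
    have hval : t ⟨⟨m + κ, ha⟩, ⟨e, he⟩⟩ = Φ (m + κ) e := by
      rw [hbas _ ha _ heT.2]
      exact (paramVal_mk t ⟨⟨m + κ, ha⟩, ⟨e, he⟩⟩).symm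
    rw [hval]
    simp only [productTangent, LinearMap.coe_mk, AddHom.coe_mk, add_tsub_cancel_left]
    have hext : ∀ e, extZero (fun b : {b | r b m} => h b.1) e = h e :=
      extZero_of_support fun e he => show e ∈ {b | r b m} from hhr e he
    rw [hext]
    by_cases hme : m ≤ e
    · obtain ⟨e', rfl⟩ := le_iff_exists_add.1 hme
      have he'K : e' ∉ K := fun h => heT.2 (hmK _ h)
      rw [if_pos hme, add_tsub_cancel_left]
      -- A minimal monomial of `J` is `m + κ` with `κ` minimal in `K`; thus `κ` is `n` or a minimal
      -- monomial of `J₀`.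
      have hΨ : (if κ = n then extZero (fun b : {b | r b n ∧ b ∉ mons J₀} => Ψ n b.1) e'
          else paramVal t₀ κ e') = Ψ κ e' := by
        split_ifs with hκn
        · rw [extZero]
          split_ifs with h1
          · rw [hκn]
          · by_contra h0
            rw [hκn] at h0
            exact h1 ⟨hΨrel n (Or.inr (show n ≤ n from le_rfl)) _ (Ne.symm h0),
              fun h => he'K (Or.inl h)⟩
        · refine ht₀ κ ?_ _ he'K
          have hmin : ∀ κ' ∈ K, κ' ≤ κ → κ ≤ κ' := fun κ' h1 h2 =>
            le_of_add_le_add_left (ha.2 (hmK κ' h1) (add_le_add_right h2 m))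
          rcases hκ with h1 | h1
          · exact ⟨h1, fun κ' h2 h3 => hmin κ' (Or.inl h2) h3⟩
          · exact absurd (le_antisymm (hmin n (Or.inr (show n ≤ n from le_rfl)) h1) h1) hκn
      rw [hΨ]
      simp only [Ψ]
      ring
    · rw [if_neg hme, add_zero, hheq κ hκ e hme]

end Decomposition

/-! ### From separating tangent vectors to generating the ring -/

section Duality

variable {k : Type*} [Field k] {B : Type*} [CommRing B] [Algebra k B] {C' : Type*}

theorem map_monomial_one (q : MvPolynomial C' k →ₐ[k] B) (d : C' →₀ ℕ) :
    q (monomial d 1) = d.prod fun c n => q (X c) ^ n := by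
  have h := aeval_unique q
  conv_lhs => rw [h]
  rw [aeval_monomial, map_one, one_mul]
  rfl

/-- A linear form that vanishes on constants and on products of at least two generators is
a derivation at the origin. -/
theorem derivAt_eq (q : MvPolynomial C' k →ₐ[k] B) {ℓ : B →ₗ[k] k} (h1 : ℓ 1 = 0)
    (h2 : ∀ d : C' →₀ ℕ, 2 ≤ d.degree → ℓ (d.prod fun c n => q (X c) ^ n) = 0)
    (p : MvPolynomial C' k) : derivAt p (fun c => ℓ (q (X c))) = ℓ (q p) := by
  induction p using MvPolynomial.induction_on with
  | C a =>
    rw [derivAt_apply, snd_tangentHom_C, ← algebraMap_eq, AlgHom.commutes,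
      Algebra.algebraMap_eq_smul_one, map_smul, h1, smul_zero]
  | add p p' hp hp' =>
    rw [map_add, map_add, ← hp, ← hp', derivAt_apply, derivAt_apply, derivAt_apply, map_add,
      TrivSqZeroExt.snd_add]
  | mul_X p c _ =>
    rw [derivAt_apply, snd_tangentHom_mul_X]
    clear * - h1 h2
    classical
    induction p using MvPolynomial.induction_on' with
    | monomial d a =>
      have hm : monomial d a * X c = a • monomial (d + Finsupp.single c 1) (1 : k) := by
        rw [X, monomial_mul, mul_one, smul_monomial, smul_eq_mul, mul_one]
      rw [hm, map_smul, map_smul, smul_eq_mul, constantCoeff_monomial]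
      by_cases hd : d = 0
      · rw [if_pos hd, hd, zero_add]
        rfl
      · rw [if_neg hd, zero_mul, map_monomial_one, h2, mul_zero]
        rw [map_add, Finsupp.degree_single]
        have : d.degree ≠ 0 := by rwa [Ne, Finsupp.degree_eq_zero_iff]
        omega
    | add p p' hp hp' => rw [map_add, add_mul, hp, hp', add_mul, map_add, map_add]

variable {σ : Type} {ord : MonomialOrder.{0, v} σ} {ι : Type*}

/-- If the elements `y` separate the tangent vectors at the origin, they generate the algebra. -/
theorem adjoin_eq_top_of_coaction [Finite C'] (q : MvPolynomial C' k →ₐ[k] B)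
    (hq : Function.Surjective q) (ρ : B →ₐ[k] AddMonoidAlgebra B (σ → ℤ))
    {α β : C' → σ →₀ ℕ} (hlt : ∀ c, β c ≺[ord] α c)
    (hx : ∀ c, ρ (q (X c)) = AddMonoidAlgebra.single (wt (α c) - wt (β c)) (q (X c)))
    {y : ι → B} {γ : ι → σ → ℤ} (hy : ∀ j, ρ (y j) = AddMonoidAlgebra.single (γ j) (y j))
    (h : ∀ ℓ : B →ₗ[k] k, ℓ 1 = 0 →
      (∀ d : C' →₀ ℕ, 2 ≤ d.degree → ℓ (d.prod fun c n => q (X c) ^ n) = 0) →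
      (∀ j, ℓ (y j) = 0) → ∀ c, ℓ (q (X c)) = 0) :
    Algebra.adjoin k (Set.range y) = ⊤ := by
  have hgen : ∀ c, q (X c) ∈ Algebra.adjoin k (Set.range y) := by
    refine mem_adjoin_of_coaction ρ hlt hx hy fun c => ?_
    by_contra hc
    -- If the Nakayama hypothesis fails at `c`, some linear form detects this. It kills constants
    -- and products of two or more generators, so it is a tangent vector, and it kills every `y j`.
    obtain ⟨ℓ, hne, hle⟩ := Submodule.exists_le_ker_of_notMem hc
    rw [sup_le_iff, Submodule.span_le, Submodule.span_le] at hle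
    refine hne (h ℓ (hle.1 (Set.mem_insert _ _)) (fun d hd => hle.2 ⟨d, hd, rfl⟩)
      (fun j => hle.1 (Set.mem_insert_of_mem _ ⟨j, rfl⟩)) c)
  rw [eq_top_iff]
  rintro b -
  obtain ⟨p, rfl⟩ := hq b
  induction p using MvPolynomial.induction_on with
  | C a => rw [← algebraMap_eq, AlgHom.commutes]; exact Subalgebra.algebraMap_mem _ a
  | add p p' hp hp' => rw [map_add]; exact add_mem hp hp'
  | mul_X p c hp => rw [map_mul]; exact mul_mem hp (hgen c)

/-- The kernels of the iterates stabilize, say at `n`. An element of the kernel of `f` is `f^n y`;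
then `y` is in the kernel of `f^(n+1)`, hence in that of `f^n`. -/
theorem injective_of_surjective_endo {R : Type*} [CommRing R] [IsNoetherianRing R]
    (f : R →+* R) (hf : Function.Surjective f) : Function.Injective f := by
  let K : ℕ →o Submodule R R :=
    ⟨fun n => RingHom.ker (f ^ n), monotone_nat_of_le_succ fun n x hx => by
      rw [RingHom.mem_ker] at hx ⊢
      rw [pow_succ', RingHom.mul_def, RingHom.comp_apply, hx, map_zero]⟩
  obtain ⟨n, hn⟩ := monotone_stabilizes_iff_noetherian.2 ‹IsNoetherianRing R› K
  have hsurj : Function.Surjective (f ^ n) := by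
    rw [RingHom.coe_pow]; exact hf.iterate n
  rw [injective_iff_map_eq_zero]
  intro x hx
  obtain ⟨y, rfl⟩ := hsurj x
  have h1 : y ∈ K (n + 1) := by
    change y ∈ RingHom.ker (f ^ (n + 1))
    rw [RingHom.mem_ker, pow_succ', RingHom.mul_def, RingHom.comp_apply, hx]
  rw [← hn (n + 1) (Nat.le_succ n)] at h1
  exact h1

end Duality

/-! ### Generators of the coordinate ring and the tangent dimension -/

section Generators

variable {k : Type u} [Field k] {σ : Type} [Finite σ] {ord : MonomialOrder.{0, v} σ}
  {r : (σ →₀ ℕ) → (σ →₀ ℕ) → Prop}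
  {J : Ideal (MvPolynomial σ k)} {T : (σ →₀ ℕ) → Set (σ →₀ ℕ)}

theorem finite_params (hfin : ∀ a, (T a).Finite) : Finite (Params J T) := by
  have := finite_monBasis (J := J)
  have : ∀ a : monBasis J, Finite (T a.1) := fun a => hfin a.1
  infer_instance

/-- A tangent vector is a homomorphism to `k[ε]` over the origin, so it is determined by the
`ε`-parts of its values at `N` polynomial generators. -/
theorem finrank_tangentSpace_le (hr : TailRel ord r) (hfin : ∀ a, (T a).Finite)
    (hT : ∀ a, ∀ b ∈ T a, r b a) (R : SReductions ord J T) {N : ℕ}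
    (e : StratumRing R ≃ₐ[k] MvPolynomial (Fin N) k) :
    Module.finrank k (tangentSpace R) ≤ N := by
  have hz : ∀ j, ∃ z : MvPolynomial (Params J T) k, Ideal.Quotient.mkₐ k (stratumIdeal R) z =
      e.symm (X j) := fun j => Ideal.Quotient.mkₐ_surjective _ _ _
  choose z hz using hz
  have hlift : ∀ t ∈ tangentSpace R, ∀ p ∈ stratumIdeal R, tangentHom t p = 0 :=
    fun t ht p hp => (mem_tangentSpace_iff hr hfin hT).1 ht hp
  let Λ : tangentSpace R →ₗ[k] (Fin N → k) :=
    (LinearMap.pi fun j => derivAt (z j)) ∘ₗ (tangentSpace R).subtype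
  have hinj : Function.Injective Λ := by
    rw [injective_iff_map_eq_zero]
    intro t ht
    let θ : ∀ t ∈ tangentSpace R, StratumRing R →ₐ[k] DualNumber k := fun t ht =>
      Ideal.Quotient.liftₐ (stratumIdeal R) (tangentHom t) (hlift t ht)
    have hθ : ∀ t ht p, θ t ht (Ideal.Quotient.mkₐ k (stratumIdeal R) p) = tangentHom t p :=
      fun t ht p => rfl
    have h0 := zero_mem (tangentSpace R)
    have heq : (θ t.1 t.2).comp e.symm.toAlgHom = (θ 0 h0).comp e.symm.toAlgHom := by
      apply MvPolynomial.algHom_ext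
      intro j
      change θ t.1 t.2 (e.symm (X j)) = θ 0 h0 (e.symm (X j))
      rw [← hz j, hθ _ t.2, hθ _ h0]
      apply TrivSqZeroExt.ext
      · rw [fst_tangentHom, fst_tangentHom]
      · rw [← derivAt_apply, ← derivAt_apply, map_zero]
        exact congrFun ht j
    ext c
    have h1 := DFunLike.congr_fun heq (e (Ideal.Quotient.mkₐ k (stratumIdeal R) (X c)))
    change θ t.1 t.2 (e.symm (e _)) = θ 0 h0 (e.symm (e _)) at h1
    rw [AlgEquiv.symm_apply_apply, hθ _ t.2, hθ _ h0, tangentHom_X, tangentHom_X] at h1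
    exact congrArg TrivSqZeroExt.snd h1
  have := LinearMap.finrank_le_finrank_of_injective hinj
  rwa [Module.finrank_fin_fun] at this

/-- The coordinate ring of the stratum is generated by as many elements as the dimension
of the tangent space at the origin. -/
theorem exists_surjective_of_finrank_le (hr : TailRel ord r) (hfin : ∀ a, (T a).Finite)
    (hT : ∀ a, ∀ b ∈ T a, r b a) (R : SReductions ord J T) {N : ℕ}
    (hN : Module.finrank k (tangentSpace R) ≤ N) :
    ∃ g : MvPolynomial (Fin N) k →ₐ[k] StratumRing R, Function.Surjective g := by
  classical
  have hfinP := finite_params (J := J) hfin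
  obtain ⟨ρ, hρ⟩ := exists_coaction hr hfin hT R
  let co : Params J T → Module.Dual k (tangentSpace R) := fun c =>
    LinearMap.proj c ∘ₗ (tangentSpace R).subtype
  obtain ⟨b, hb, hspan, hli⟩ := exists_linearIndependent k (Set.range co)
  have hbfin : Finite b := (Set.finite_range co).subset hb
  have hcard : Nat.card b ≤ N := by
    have := Fintype.ofFinite b
    have h1 := hli.fintype_card_le_finrank
    rw [Subspace.dual_finrank_eq] at h1
    rw [Nat.card_eq_fintype_card]
    exact h1.trans hN
  have hpre : ∀ f : b, ∃ c, co c = f.1 := fun f => hb f.2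
  choose c hc using hpre
  have htop : Algebra.adjoin k (Set.range fun f : b => stratumVar R (c f)) = ⊤ := by
    refine adjoin_eq_top_of_coaction (ord := ord) (Ideal.Quotient.mkₐ k (stratumIdeal R))
      (Ideal.Quotient.mkₐ_surjective _ _) ρ (α := fun c => c.1.1) (β := fun c => c.2.1)
      (fun c => hr.lt (hT _ _ c.2.2)) hρ (fun f => hρ (c f)) ?_
    intro ℓ h1 h2 h3 c'
    have ht : (fun c => ℓ (Ideal.Quotient.mkₐ k (stratumIdeal R) (X c))) ∈ tangentSpace R := by
      rw [mem_tangentSpace]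
      intro p hp
      rw [derivAt_eq _ h1 h2]
      have : Ideal.Quotient.mkₐ k (stratumIdeal R) p = 0 := Ideal.Quotient.eq_zero_iff_mem.2 hp
      rw [this, map_zero]
    have hle : Submodule.span k b ≤ LinearMap.ker (Module.Dual.eval k (tangentSpace R) ⟨_, ht⟩) := by
      rw [Submodule.span_le]
      intro f hf
      have := h3 ⟨f, hf⟩
      have h4 : f = co (c ⟨f, hf⟩) := (hc ⟨f, hf⟩).symm
      rw [SetLike.mem_coe, LinearMap.mem_ker, Module.Dual.eval_apply, h4]
      exact this
    rw [hspan] at hle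
    exact hle (Submodule.subset_span ⟨c', rfl⟩)
  obtain ⟨i⟩ : Nonempty (b ↪ Fin N) := by
    have := Fintype.ofFinite b
    refine Function.Embedding.nonempty_of_card_le ?_
    rwa [Fintype.card_fin, ← Nat.card_eq_fintype_card]
  -- There may be fewer generators than `N`; `killCompl` sends the surplus variables to zero.
  refine ⟨(aeval fun f : b => stratumVar R (c f)).comp (killCompl i.injective), ?_⟩
  rw [AlgHom.coe_comp]
  refine Function.Surjective.comp ?_ ?_
  · rw [← AlgHom.range_eq_top, ← htop, Algebra.adjoin_range_eq_range_aeval]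
  · intro p
    exact ⟨rename i p, killCompl_rename_app i.injective p⟩

end Generators

/-! ### First order products and base change of the family -/

section FirstOrder

variable {k : Type u} [Field k] {σ : Type}

/-- The product rule: the two first order parts multiply to zero because `ε² = 0`. -/
theorem coeff_mul_of_firstOrder {f g : MvPolynomial σ (DualNumber k)} {m n : σ →₀ ℕ}
    {u v : (σ →₀ ℕ) → k}
    (hf : open Classical in ∀ e, f.coeff e = (if e = m then 1 else 0) + TrivSqZeroExt.inr (u e))
    (hg : open Classical in ∀ e, g.coeff e = (if e = n then 1 else 0) + TrivSqZeroExt.inr (v e))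
    {e : σ →₀ ℕ} (he : e ≠ m + n) : open Classical in
    (f * g).coeff e =
      TrivSqZeroExt.inr ((if n ≤ e then u (e - n) else 0) + (if m ≤ e then v (e - m) else 0)) := by
  classical
  have hu : ∀ e, (f - monomial m 1).coeff e = TrivSqZeroExt.inr (u e) := by
    intro e
    rw [coeff_sub, hf, coeff_monomial]
    simp only [eq_comm, add_sub_cancel_left]
  have hv : ∀ e, (g - monomial n 1).coeff e = TrivSqZeroExt.inr (v e) := by
    intro e
    rw [coeff_sub, hg, coeff_monomial]
    simp only [eq_comm, add_sub_cancel_left]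
  have huv : (f - monomial m 1) * (g - monomial n 1) = 0 := by
    ext1 d
    rw [coeff_mul, coeff_zero]
    refine Finset.sum_eq_zero fun x _ => ?_
    rw [hu, hv, TrivSqZeroExt.inr_mul_inr]
  have hfg : f * g = monomial (m + n) 1 + monomial n 1 * (f - monomial m 1) +
      monomial m 1 * (g - monomial n 1) := by
    have h1 : (monomial (m + n) 1 : MvPolynomial σ (DualNumber k)) = monomial m 1 * monomial n 1 := by
      rw [monomial_mul, one_mul]
    rw [h1]
    linear_combination huv
  rw [hfg, coeff_add, coeff_add, coeff_monomial, if_neg he.symm, zero_add, coeff_monomial_mul',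
    coeff_monomial_mul', hu, hv, TrivSqZeroExt.inr_add, one_mul, one_mul]
  congr 1 <;> split_ifs <;> simp

theorem coeff_tailPoly_inr {a : σ →₀ ℕ} {D : Set (σ →₀ ℕ)} (hfin : D.Finite) (ha : a ∉ D)
    (c : D → k) (e : σ →₀ ℕ) : open Classical in
    (tailPoly a D (fun b => (TrivSqZeroExt.inr (c b) : DualNumber k))).coeff e =
      (if e = a then 1 else 0) + TrivSqZeroExt.inr (extZero c e) := by
  classical
  rw [coeff_tailPoly hfin ha, extZero]
  by_cases h1 : e = a
  · rw [if_pos h1, if_pos h1, dif_neg (by rwa [h1]), TrivSqZeroExt.inr_zero, add_zero]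
  · rw [if_neg h1, if_neg h1, zero_add]
    split_ifs <;> simp

end FirstOrder

section Universal

variable {k : Type u} [Field k] {σ : Type} {J₀ : Ideal (MvPolynomial σ k)}
  {T₀ : (σ →₀ ℕ) → Set (σ →₀ ℕ)} {D : Type*} {B₀ : Type*} [CommRing B₀] [Algebra k B₀]

theorem map_mem_prodIdeal {A B : Type*} [CommRing A] [CommRing B]
    {θ : MvPolynomial (Params J₀ T₀) k →+* A} {f g p : MvPolynomial σ A}
    (hp : p ∈ prodIdeal J₀ T₀ θ f g) (η : A →+* B) :
    MvPolynomial.map η p ∈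
      prodIdeal J₀ T₀ (η.comp θ) (MvPolynomial.map η f) (MvPolynomial.map η g) := by
  have h := Ideal.mem_map_of_mem (MvPolynomial.map η) hp
  rw [prodIdeal, specIdeal, Ideal.map_mul, Ideal.map_sup, Ideal.map_span, Ideal.map_span,
    Ideal.map_span, Set.image_singleton, Set.image_singleton, ← Set.range_comp] at h
  have hc : (MvPolynomial.map η ∘ fun a : monBasis J₀ => MvPolynomial.map θ (genericPoly J₀ T₀ a)) =
      fun a => MvPolynomial.map (η.comp θ) (genericPoly J₀ T₀ a) := by
    ext1 a
    exact MvPolynomial.map_map _ _ _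
  rw [hc] at h
  exact h

/-- The presentation of a polynomial ring over a quotient of a polynomial ring. -/
def joinHom {C : Type*} (q₀ : MvPolynomial C k →ₐ[k] B₀) (D : Type*) :
    MvPolynomial (C ⊕ D) k →ₐ[k] MvPolynomial D B₀ :=
  aeval (Sum.elim (fun c => MvPolynomial.C (q₀ (X c))) X)

theorem joinHom_rename {C : Type*} (q₀ : MvPolynomial C k →ₐ[k] B₀) (p : MvPolynomial C k) :
    joinHom q₀ D (rename Sum.inl p) = MvPolynomial.C (q₀ p) := by
  rw [joinHom, aeval_rename, Sum.elim_comp_inl]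
  have : (aeval fun c => MvPolynomial.C (q₀ (X c))) =
      (IsScalarTower.toAlgHom k B₀ (MvPolynomial D B₀)).comp q₀ := by
    apply MvPolynomial.algHom_ext
    intro c
    rw [aeval_X]
    rfl
  rw [this]
  rfl

theorem joinHom_surjective {C : Type*} {q₀ : MvPolynomial C k →ₐ[k] B₀}
    (hq₀ : Function.Surjective q₀) (D : Type*) : Function.Surjective (joinHom q₀ D) := by
  intro p
  induction p using MvPolynomial.induction_on with
  | C b =>
    obtain ⟨p, rfl⟩ := hq₀ b
    exact ⟨_, joinHom_rename q₀ p⟩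
  | add p q hp hq =>
    obtain ⟨a, rfl⟩ := hp
    obtain ⟨b, rfl⟩ := hq
    exact ⟨a + b, map_add _ _ _⟩
  | mul_X p d hp =>
    obtain ⟨a, rfl⟩ := hp
    refine ⟨a * X (Sum.inr d), ?_⟩
    rw [map_mul]
    congr 1
    exact aeval_X _ _

/-- The extension of a torus action to a polynomial ring. -/
def joinCoaction (ρ₀ : B₀ →ₐ[k] AddMonoidAlgebra B₀ (σ → ℤ)) (w : D → σ → ℤ) :
    MvPolynomial D B₀ →ₐ[k] AddMonoidAlgebra (MvPolynomial D B₀) (σ → ℤ) :=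
  aevalTower ((AddMonoidAlgebra.mapAlgHom (σ → ℤ)
    (IsScalarTower.toAlgHom k B₀ (MvPolynomial D B₀))).comp ρ₀)
    (fun d => AddMonoidAlgebra.single (w d) (X d))

theorem joinCoaction_X (ρ₀ : B₀ →ₐ[k] AddMonoidAlgebra B₀ (σ → ℤ)) (w : D → σ → ℤ) (d : D) :
    joinCoaction ρ₀ w (X d) = AddMonoidAlgebra.single (w d) (X d) :=
  aevalTower_X _ _ _

theorem joinCoaction_C {ρ₀ : B₀ →ₐ[k] AddMonoidAlgebra B₀ (σ → ℤ)} (w : D → σ → ℤ) {b : B₀}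
    {γ : σ → ℤ} (hb : ρ₀ b = AddMonoidAlgebra.single γ b) :
    joinCoaction ρ₀ w (MvPolynomial.C b) = AddMonoidAlgebra.single γ (MvPolynomial.C b) := by
  rw [joinCoaction, aevalTower_C, AlgHom.comp_apply, hb]
  exact AddMonoidAlgebra.mapAlgHom_single _ _ _

/-- An augmentation that kills the generators kills all elements of nonzero weight. -/
theorem augmentation_eq_zero {C' P : Type*} [CommRing P] [Algebra k P]
    {q : MvPolynomial C' k →ₐ[k] P} (hq : Function.Surjective q)
    {ρ : P →ₐ[k] AddMonoidAlgebra P (σ → ℤ)} {w : C' → σ → ℤ}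
    (hρ : ∀ c, ρ (q (X c)) = AddMonoidAlgebra.single (w c) (q (X c)))
    (aug : P →ₐ[k] k) (haug : ∀ c, aug (q (X c)) = 0) {γ : σ → ℤ} (hγ : γ ≠ 0) {p : P}
    (hp : p ∈ wtPart ρ γ) : aug p = 0 := by
  have key : ((AddMonoidAlgebra.mapAlgHom (σ → ℤ) aug).comp ρ).comp q =
      ((Algebra.ofId k (AddMonoidAlgebra k (σ → ℤ))).comp aug).comp q := by
    apply MvPolynomial.algHom_ext
    intro c
    simp only [AlgHom.comp_apply]
    rw [hρ, haug, map_zero]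
    rw [AddMonoidAlgebra.mapAlgHom_single, haug, AddMonoidAlgebra.single_zero]
  obtain ⟨z, rfl⟩ := hq p
  have h1 := DFunLike.congr_fun key z
  simp only [AlgHom.comp_apply] at h1
  rw [mem_wtPart.1 hp, AddMonoidAlgebra.mapAlgHom_single] at h1
  have h3 := congrArg (fun s => AddMonoidAlgebra.coeff s γ) h1
  rw [AddMonoidAlgebra.coeff_single, Finsupp.single_eq_same] at h3
  rw [h3, Algebra.ofId_apply, Algebra.algebraMap_eq_smul_one, AddMonoidAlgebra.one_def,
    AddMonoidAlgebra.smul_single, AddMonoidAlgebra.coeff_single, Finsupp.single_eq_of_ne hγ]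

end Universal

/-! ### The product morphism and its injectivity on tangent vectors -/

section Main

variable {k : Type u} [Field k] {X Y : Type} [Finite X] [Finite Y] {ord : MonomialOrder.{0, v} (X ⊕ Y)}
  {r : (X ⊕ Y →₀ ℕ) → (X ⊕ Y →₀ ℕ) → Prop} {J₀ J : Ideal (MvPolynomial (X ⊕ Y) k)}
  {T₀ T : (X ⊕ Y →₀ ℕ) → Set (X ⊕ Y →₀ ℕ)} {m n : X ⊕ Y →₀ ℕ}

/-- A tangent vector that is sent to zero by multiplication of the factors is zero. -/
theorem eq_zero_of_heads_mem_prodIdeal (hr : TailRel ord r)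
    (hrfin : ∀ a, {b | r b a}.Finite) (hfin₀ : ∀ a, (T₀ a).Finite)
    (hT₀ : ∀ a e, e ∈ T₀ a ↔ r e a ∧ e ∉ mons J₀ ∧ ¬ n ≤ e)
    {S : Set (X ⊕ Y →₀ ℕ)} (hS : S.Nonempty)
    (hSX : ∀ s ∈ S, ∀ y, s (Sum.inr y) = 0) (hM₀ : ∀ e, e ∈ mons J₀ ↔ ∃ s ∈ S, s ≤ e)
    (hm : ∀ x, m (Sum.inl x) = 0)
    (hn' : ∀ e, e + n ∈ mons J₀ → e ∈ mons J₀)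
    (hJ : ∀ w, w ∈ mons J ↔ ∃ κ ∈ mons J₀ ∪ {w | n ≤ w}, w = m + κ)
    (R₀ : SReductions ord J₀ T₀) {t₀ : Params J₀ T₀ → k} (ht₀ : t₀ ∈ tangentSpace R₀)
    (h : {b | r b m} → k) (ψ : {b | r b n ∧ b ∉ mons J₀} → k)
    (hmem : ∀ a : monBasis J, monomial a.1 (1 : DualNumber k) ∈
      prodIdeal J₀ T₀ (tangentHom t₀ : _ →+* DualNumber k)
        (tailPoly m {b | r b m} fun b => TrivSqZeroExt.inr (h b))
        (tailPoly n {b | r b n ∧ b ∉ mons J₀} fun b => TrivSqZeroExt.inr (ψ b))) :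
    (∀ b, h b = 0) ∧ (∀ b, ψ b = 0) ∧ ∀ c, t₀ c = 0 := by
  classical
  have hT₀' : ∀ a, ∀ b ∈ T₀ a, r b a := fun a b h => ((hT₀ a b).1 h).1
  have hmD : m ∉ {b | r b m} := fun h => lt_irrefl _ (hr.lt h)
  have hnD : n ∉ {b | r b n ∧ b ∉ mons J₀} := fun h => lt_irrefl _ (hr.lt h.1)
  have hDfin : {b | r b n ∧ b ∉ mons J₀}.Finite := (hrfin n).subset fun b hb => hb.1
  set f : MvPolynomial (X ⊕ Y) (DualNumber k) :=
    tailPoly m {b | r b m} fun b => TrivSqZeroExt.inr (h b) with hf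
  set g : MvPolynomial (X ⊕ Y) (DualNumber k) :=
    tailPoly n {b | r b n ∧ b ∉ mons J₀} fun b => TrivSqZeroExt.inr (ψ b) with hg
  have hL : LeadIn ord (mons J) (prodIdeal J₀ T₀ (tangentHom t₀ : _ →+* DualNumber k) f g) :=
    leadIn_prodIdeal hr hfin₀ hT₀' R₀ hn' hJ _
      ((mem_tangentSpace_iff hr hfin₀ hT₀').1 ht₀)
      (hasHead_tailPoly (hrfin m) hmD (fun b hb => hb) _)
      (hasHead_tailPoly hDfin hnD (fun b hb => hb.1) _)
  have hmon : ∀ e ∈ mons J, ∀ c, monomial e c ∈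
      prodIdeal J₀ T₀ (tangentHom t₀ : _ →+* DualNumber k) f g := by
    intro e he c
    obtain ⟨a, ha⟩ := mem_mons_iff.1 he
    have := Ideal.mul_mem_left _ (monomial (e - a.1) c) (hmem a)
    rwa [monomial_mul, mul_one, tsub_add_cancel_of_le ha] at this
  have key : ∀ (κ : X ⊕ Y →₀ ℕ) (G : MvPolynomial (X ⊕ Y) (DualNumber k)) (ψ' : (X ⊕ Y →₀ ℕ) → k),
      κ ∈ mons J₀ ∪ {w | n ≤ w} →
      G ∈ specIdeal J₀ T₀ (tangentHom t₀ : _ →+* DualNumber k) ⊔ Ideal.span {g} →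
      (∀ e, G.coeff e = (if e = κ then 1 else 0) + TrivSqZeroExt.inr (ψ' e)) → ∀ e ∉ mons J,
      (if κ ≤ e then extZero h (e - κ) else 0) + (if m ≤ e then ψ' (e - m) else 0) = 0 := by
    intro κ G ψ' hκ hG hco e he
    have h1 : f * G ∈ prodIdeal J₀ T₀ (tangentHom t₀ : _ →+* DualNumber k) f g :=
      Ideal.mul_mem_mul (Ideal.subset_span rfl) hG
    have h2 := hL.coeff_eq_zero h1 (fun d hd => hmon d hd _) he
    have hne : e ≠ m + κ := fun h => he ((hJ e).2 ⟨κ, hκ, h⟩)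
    rw [coeff_mul_of_firstOrder (coeff_tailPoly_inr (hrfin m) hmD h)
      (fun e => by convert hco e) hne] at h2
    have h3 := congrArg TrivSqZeroExt.snd h2
    rw [TrivSqZeroExt.snd_inr, TrivSqZeroExt.snd_zero] at h3
    convert h3
  have keyu : ∀ u : monBasis J₀, ∀ e ∉ mons J, (if u.1 ≤ e then extZero h (e - u.1) else 0) +
      (if m ≤ e then paramVal t₀ u.1 (e - m) else 0) = 0 := by
    intro u
    refine key u.1 _ (paramVal t₀ u.1) (Or.inl u.2.1)
      (Ideal.mem_sup_left (Ideal.subset_span ⟨u, rfl⟩)) fun e => ?_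
    have := coeff_map_tangentHom hr hfin₀ hT₀' t₀ u le_rfl e
    rw [shiftVal, tsub_self, if_pos zero_le, tsub_zero, ← MvPolynomial.one_def, one_mul] at this
    convert this
  have keyn : ∀ e ∉ mons J, (if n ≤ e then extZero h (e - n) else 0) +
      (if m ≤ e then extZero ψ (e - m) else 0) = 0 :=
    key n g (extZero ψ) (Or.inr (show n ≤ n from le_rfl)) (Ideal.mem_sup_right (Ideal.subset_span rfl))
      (fun e => by convert coeff_tailPoly_inr hDfin hnD ψ e)
  have hh : ∀ b, h b = 0 := by
    intro b
    obtain ⟨s, hs⟩ := hS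
    obtain ⟨u, hu⟩ := mem_mons_iff.1 ((hM₀ s).2 ⟨s, hs, le_rfl⟩)
    have huX : ∀ y, u.1 (Sum.inr y) = 0 := fun y => by
      have := hu (Sum.inr y)
      rw [hSX s hs y] at this
      exact Nat.le_zero.1 this
    -- As `u` involves only `X` and `b ≺ m`, `m` does not divide `b + u`. The coefficient of `f ·
    -- F_u` there is therefore `h b` alone. Once `h = 0`, coefficients at multiples of `m` isolate
    -- `ψ` and `t₀`.
    have hmb : ¬ m ≤ b.1 + u.1 := by
      intro hle
      have hle' : m ≤ b.1 := by
        rintro (x | y)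
        · rw [hm x]; exact Nat.zero_le _
        · have := hle (Sum.inr y)
          rwa [Finsupp.add_apply, huX y, add_zero] at this
      exact absurd (ord.toSyn_monotone hle') (not_le.2 (hr.lt b.2))
    have hbJ : b.1 + u.1 ∉ mons J := by
      intro hb
      obtain ⟨κ, -, heq⟩ := (hJ _).1 hb
      exact hmb (heq ▸ le_self_add)
    have h1 := keyu u _ hbJ
    rw [if_pos le_add_self, if_neg hmb, add_zero, add_tsub_cancel_right, extZero, dif_pos b.2] at h1
    exact h1
  have hext : ∀ e, extZero h e = 0 := fun e => by
    rw [extZero]; split_ifs; exacts [hh _, rfl]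
  have hnK : ∀ e, e ∉ mons J₀ → ¬ n ≤ e → m + e ∉ mons J := by
    intro e h1 h2 h3
    obtain ⟨κ, hκ, heq⟩ := (hJ _).1 h3
    rw [← add_left_cancel heq] at hκ
    rcases hκ with h | h
    exacts [h1 h, h2 h]
  refine ⟨hh, fun b => ?_, fun c => ?_⟩
  · have h1 := keyn (m + b.1) (hnK _ b.2.2 fun h =>
      absurd (ord.toSyn_monotone h) (not_le.2 (hr.lt b.2.1)))
    rw [hext, ite_self, zero_add, if_pos le_self_add, add_tsub_cancel_left, extZero, dif_pos b.2] at h1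
    exact h1
  · have h2 := (hT₀ _ _).1 c.2.2
    have h1 := keyu c.1 (m + c.2.1) (hnK _ h2.2.1 h2.2.2)
    rwa [hext, ite_self, zero_add, if_pos le_self_add, add_tsub_cancel_left, paramVal_mk] at h1

/-- The parameters of `St(J)` go to the coefficients of the reduced basis of the product ideal over
`B₀` with the coefficients of `f` and `g` adjoined. These are weight vectors, so surjectivity
reduces to tangent vectors at the origin: one that kills all of them makes the reduced basis
monomial to first order, and hence vanishes. -/
theorem exists_surjective_product (hr : TailRel ord r)
    (hrfin : ∀ a, {b | r b a}.Finite) (hfin₀ : ∀ a, (T₀ a).Finite) (hfin : ∀ a, (T a).Finite)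
    (hT₀ : ∀ a e, e ∈ T₀ a ↔ r e a ∧ e ∉ mons J₀ ∧ ¬ n ≤ e)
    (hT : ∀ a e, e ∈ T a ↔ r e a ∧ e ∉ mons J)
    {S : Set (X ⊕ Y →₀ ℕ)} (hS : S.Nonempty)
    (hSX : ∀ s ∈ S, ∀ y, s (Sum.inr y) = 0) (hM₀ : ∀ e, e ∈ mons J₀ ↔ ∃ s ∈ S, s ≤ e)
    (hm : ∀ x, m (Sum.inl x) = 0)
    (hn' : ∀ e, e + n ∈ mons J₀ → e ∈ mons J₀)
    (hJ : ∀ w, w ∈ mons J ↔ ∃ κ ∈ mons J₀ ∪ {w | n ≤ w}, w = m + κ)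
    (R₀ : SReductions ord J₀ T₀) (R : SReductions ord J T)
    {B₀ : Type*} [CommRing B₀] [Algebra k B₀] (q₀ : MvPolynomial (Params J₀ T₀) k →ₐ[k] B₀)
    (hq₀ : Function.Surjective q₀) (hker : ∀ p ∈ stratumIdeal R₀, q₀ p = 0)
    (hlift : ∀ t ∈ tangentSpace R₀, ∃ θ : B₀ →ₐ[k] DualNumber k, ∀ p, θ (q₀ p) = tangentHom t p)
    (ρ₀ : B₀ →ₐ[k] AddMonoidAlgebra B₀ (X ⊕ Y → ℤ))
    (hρ₀ : ∀ c : Params J₀ T₀, ρ₀ (q₀ (MvPolynomial.X c)) =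
      AddMonoidAlgebra.single (wt c.1.1 - wt c.2.1) (q₀ (MvPolynomial.X c))) :
    ∃ φ : MvPolynomial (Params J T) k →ₐ[k]
        MvPolynomial ({b | r b m} ⊕ {b | r b n ∧ b ∉ mons J₀}) B₀,
      Function.Surjective φ ∧ ∀ p ∈ stratumIdeal R, φ p = 0 := by
  classical
  have hT' : ∀ a, ∀ b ∈ T a, r b a := fun a b h => ((hT a b).1 h).1
  have hT₀' : ∀ a, ∀ b ∈ T₀ a, r b a := fun a b h => ((hT₀ a b).1 h).1
  have hmD : m ∉ {b | r b m} := fun h => lt_irrefl _ (hr.lt h)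
  have hnD : n ∉ {b | r b n ∧ b ∉ mons J₀} := fun h => lt_irrefl _ (hr.lt h.1)
  have hDfin : {b | r b n ∧ b ∉ mons J₀}.Finite := (hrfin n).subset fun b hb => hb.1
  have hfinP := finite_params (J := J₀) hfin₀
  have hfinD₁ : Finite {b | r b m} := hrfin m
  have hfinD₂ : Finite {b | r b n ∧ b ∉ mons J₀} := hDfin
  let q := joinHom q₀ ({b | r b m} ⊕ {b | r b n ∧ b ∉ mons J₀})
  have hq : Function.Surjective q := joinHom_surjective hq₀ _
  let α : Params J₀ T₀ ⊕ ({b | r b m} ⊕ {b | r b n ∧ b ∉ mons J₀}) → (X ⊕ Y →₀ ℕ) :=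
    Sum.elim (fun c => c.1.1) (Sum.elim (fun _ => m) (fun _ => n))
  let β : Params J₀ T₀ ⊕ ({b | r b m} ⊕ {b | r b n ∧ b ∉ mons J₀}) → (X ⊕ Y →₀ ℕ) :=
    Sum.elim (fun c => c.2.1) (Sum.elim (fun b => b.1) (fun b => b.1))
  have hαβ : ∀ c, β c ≺[ord] α c := by
    rintro (c | b | b)
    exacts [hr.lt (hT₀' _ _ c.2.2), hr.lt b.2, hr.lt b.2.1]
  let ρ := joinCoaction ρ₀ (fun d : {b | r b m} ⊕ {b | r b n ∧ b ∉ mons J₀} =>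
    wt (α (Sum.inr d)) - wt (β (Sum.inr d)))
  have hqX : ∀ c, q (MvPolynomial.X c) =
      Sum.elim (fun c => C (q₀ (MvPolynomial.X c))) MvPolynomial.X c := fun c => aeval_X _ _
  have hρ : ∀ c, ρ (q (MvPolynomial.X c)) =
      AddMonoidAlgebra.single (wt (α c) - wt (β c)) (q (MvPolynomial.X c)) := by
    rintro (c | d)
    · rw [hqX]; exact joinCoaction_C _ (hρ₀ c)
    · rw [hqX]; exact joinCoaction_X _ _ _
  let ι := IsScalarTower.toAlgHom k B₀ (MvPolynomial ({b | r b m} ⊕ {b | r b n ∧ b ∉ mons J₀}) B₀)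
  let θ₀ : MvPolynomial (Params J₀ T₀) k →+* MvPolynomial ({b | r b m} ⊕ {b | r b n ∧ b ∉ mons J₀}) B₀ :=
    (ι.comp q₀ : _ →+* _)
  have hθ₀ : ∀ p, θ₀ p = C (q₀ p) := fun p => rfl
  have hθ₀ker : stratumIdeal R₀ ≤ RingHom.ker θ₀ := by
    intro p hp
    rw [RingHom.mem_ker, hθ₀, hker p hp, map_zero]
  let f : MvPolynomial (X ⊕ Y) (MvPolynomial ({b | r b m} ⊕ {b | r b n ∧ b ∉ mons J₀}) B₀) :=
    tailPoly m {b | r b m} fun b => MvPolynomial.X (Sum.inl b)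
  let g : MvPolynomial (X ⊕ Y) (MvPolynomial ({b | r b m} ⊕ {b | r b n ∧ b ∉ mons J₀}) B₀) :=
    tailPoly n {b | r b n ∧ b ∉ mons J₀} fun b => MvPolynomial.X (Sum.inr b)
  have hf : HasHead r m f := hasHead_tailPoly (hrfin m) hmD (fun b hb => hb) _
  have hg : HasHead r n g := hasHead_tailPoly hDfin hnD (fun b hb => hb.1) _
  have hL : LeadIn ord (mons J) (prodIdeal J₀ T₀ θ₀ f g) :=
    leadIn_prodIdeal hr hfin₀ hT₀' R₀ hn' hJ θ₀ hθ₀ker hf hg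
  have hF := exists_reduced hr ρ (exists_head_prodIdeal hr hfin₀ hT₀' hJ ρ θ₀
    (fun c => joinCoaction_C _ (hρ₀ c)) hf hg
    (isWtHom_tailPoly (hrfin m) hmD fun b => joinCoaction_X _ _ _)
    (isWtHom_tailPoly hDfin hnD fun b => joinCoaction_X _ _ _))
  choose! F hFm hFh hFw hFr using hF
  let φ : MvPolynomial (Params J T) k →ₐ[k]
      MvPolynomial ({b | r b m} ⊕ {b | r b n ∧ b ∉ mons J₀}) B₀ :=
    aeval fun c => (F c.1.1).coeff c.2.1
  have hφX : ∀ c, φ (MvPolynomial.X c) = (F c.1.1).coeff c.2.1 := fun c => aeval_X _ _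
  have hφw : ∀ c, φ (MvPolynomial.X c) ∈ wtPart ρ (wt c.1.1 - wt c.2.1) := fun c => by
    rw [hφX]; exact hFw _ c.1.2.1 _
  have hnotin : ∀ a : monBasis J, a.1 ∉ T a.1 := fun a h => lt_irrefl _ (hr.lt (hT' _ _ h))
  have hmap : ∀ a : monBasis J, MvPolynomial.map (φ : _ →+* _) (genericPoly J T a) = F a.1 := by
    intro a
    ext1 e
    rw [coeff_map, coeff_genericPoly hfin a (hnotin a)]
    by_cases h1 : e = a.1
    · rw [if_pos h1, h1, (hFh a.1 a.2.1).1, map_one]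
    · rw [if_neg h1]
      split_ifs with h2
      · exact hφX _
      · rw [map_zero]
        by_contra h3
        have h4 := (hFh a.1 a.2.1).2 e h1 (Ne.symm h3)
        refine h2 ((hT _ _).2 ⟨h4, fun h5 => h3 ?_⟩)
        exact (hFr a.1 a.2.1 e h5 h1).symm
  refine ⟨φ, ?_, ?_⟩
  swap
  · intro p hp
    exact stratumIdeal_le_ker R (φ : _ →+* _) hL (fun a => by rw [hmap a]; exact hFm a.1 a.2.1) hp
  have htop := adjoin_eq_top_of_coaction (ord := ord) q hq ρ hαβ hρ (y := fun c => φ (MvPolynomial.X c))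
    (γ := fun c => wt c.1.1 - wt c.2.1) hφw ?_
  · rw [← AlgHom.range_eq_top, eq_top_iff, ← htop, Algebra.adjoin_le_iff]
    rintro _ ⟨c, rfl⟩
    exact ⟨_, rfl⟩
  intro ℓ h1 h2 h3
  let t := fun c => ℓ (q (MvPolynomial.X c))
  have hder : ∀ p, derivAt p t = ℓ (q p) := derivAt_eq q h1 h2
  have htan : ∀ p, tangentHom t (rename Sum.inl p) = tangentHom (fun c => t (Sum.inl c)) p := by
    intro p
    rw [tangentHom, aeval_rename]
    rfl
  have ht₀ : (fun c => t (Sum.inl c)) ∈ tangentSpace R₀ := by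
    rw [mem_tangentSpace]
    intro p hp
    rw [derivAt_apply, ← htan, ← derivAt_apply, hder]
    have : q (rename Sum.inl p) = 0 := by
      change joinHom q₀ _ _ = 0
      rw [joinHom_rename, hker p hp, map_zero]
    rw [this, map_zero]
  obtain ⟨θ', hθ'⟩ := hlift _ ht₀
  -- The homomorphism to `k[ε]` that corresponds to `ℓ`: its `ε`-part is `ℓ`, and its other part is
  -- evaluation at the origin.
  let θ : MvPolynomial ({b | r b m} ⊕ {b | r b n ∧ b ∉ mons J₀}) B₀ →ₐ[k] DualNumber k :=
    aevalTower θ' (fun d => TrivSqZeroExt.inr (t (Sum.inr d)))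
  have hθX : ∀ d, θ (MvPolynomial.X d) = TrivSqZeroExt.inr (t (Sum.inr d)) := fun d =>
    aevalTower_X _ _ _
  have hθC : ∀ b, θ (C b) = θ' b := fun b => aevalTower_C _ _ _
  have hθq : ∀ p, θ (q p) = tangentHom t p := by
    intro p
    have : θ.comp q = tangentHom t := by
      apply MvPolynomial.algHom_ext
      rintro (c | d)
      · rw [AlgHom.comp_apply, hqX, Sum.elim_inl, hθC, hθ', tangentHom_X, tangentHom_X]
      · rw [AlgHom.comp_apply, hqX, Sum.elim_inr, hθX, tangentHom_X]
    exact DFunLike.congr_fun this p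
  have hθsnd : ∀ p, (θ p).snd = ℓ p := by
    intro p
    obtain ⟨z, rfl⟩ := hq p
    rw [hθq, ← hder, derivAt_apply]
  have hθφ : ∀ c, θ (φ (MvPolynomial.X c)) = 0 := by
    intro c
    apply TrivSqZeroExt.ext
    -- The weight `a - b` of the coefficient is nonzero because `b ≠ a`, so its value at the origin
    -- is zero.
    · refine augmentation_eq_zero hq hρ ((TrivSqZeroExt.fstHom k k k).comp θ) (fun c => ?_) ?_ (hφw c)
      · rw [AlgHom.comp_apply, hθq, tangentHom_X]
        exact TrivSqZeroExt.fst_inr k (t c)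
      · rw [sub_ne_zero]
        intro h
        have h4 := wt_injective h
        have h5 : c.2.1 ∈ T c.1.1 := c.2.2
        rw [← h4] at h5
        exact hnotin c.1 h5
    · rw [hθsnd, h3, TrivSqZeroExt.snd_zero]
  have hFmap : ∀ a : monBasis J, MvPolynomial.map (θ : _ →+* DualNumber k) (F a.1) = monomial a.1 1 := by
    intro a
    rw [← hmap a]
    ext1 e
    rw [coeff_map, coeff_map, coeff_genericPoly hfin a (hnotin a), coeff_monomial]
    by_cases h4 : e = a.1
    · rw [if_pos h4, if_pos h4.symm, map_one, map_one]
    · rw [if_neg h4, if_neg (Ne.symm h4)]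
      split_ifs with h5
      · exact hθφ _
      · rw [map_zero, map_zero]
  have hcomp : (θ : _ →+* DualNumber k).comp θ₀ =
      (tangentHom (fun c => t (Sum.inl c)) : _ →+* DualNumber k) := by
    apply RingHom.ext
    intro p
    exact (hθC _).trans (hθ' _)
  obtain ⟨e1, e2, e3⟩ := eq_zero_of_heads_mem_prodIdeal hr hrfin hfin₀ hT₀ hS hSX hM₀ hm hn' hJ R₀ ht₀
    (fun b => t (Sum.inr (Sum.inl b))) (fun b => t (Sum.inr (Sum.inr b))) (fun a => by
      have h4 := map_mem_prodIdeal (hFm a.1 a.2.1) (θ : _ →+* DualNumber k)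
      rw [hFmap, hcomp] at h4
      have h5 : MvPolynomial.map (θ : _ →+* DualNumber k) f = tailPoly m {b | r b m} fun b =>
          TrivSqZeroExt.inr (t (Sum.inr (Sum.inl b))) := by
        refine (map_tailPoly (hrfin m) hmD _ _).trans ?_
        congr 1
        ext1 b
        exact hθX _
      have h6 : MvPolynomial.map (θ : _ →+* DualNumber k) g = tailPoly n {b | r b n ∧ b ∉ mons J₀}
          fun b => TrivSqZeroExt.inr (t (Sum.inr (Sum.inr b))) := by
        refine (map_tailPoly hDfin hnD _ _).trans ?_
        congr 1
        ext1 b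
        exact hθX _
      rwa [h5, h6] at h4)
  rintro (c | b | b)
  exacts [e3 c, e1 b, e2 b]

end Main

/-! ### Comparison of the coordinate rings -/

section CoordinateRing

variable {k : Type u} [Field k] {X Y : Type} [Finite X] [Finite Y] {ord : MonomialOrder.{0, v} (X ⊕ Y)}
  {r : (X ⊕ Y →₀ ℕ) → (X ⊕ Y →₀ ℕ) → Prop} {J₀ J : Ideal (MvPolynomial (X ⊕ Y) k)}
  {T₀ T : (X ⊕ Y →₀ ℕ) → Set (X ⊕ Y →₀ ℕ)} {m n : X ⊕ Y →₀ ℕ}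

/-- If the coordinate ring of the stratum of `J₀` is a polynomial ring, then so is the coordinate
ring of the stratum of `m ((n) + J₀)`. -/
theorem nonempty_stratumRing_equiv (hr : TailRel ord r)
    (hrfin : ∀ a, {b | r b a}.Finite)
    (hT₀ : ∀ a e, e ∈ T₀ a ↔ r e a ∧ e ∉ mons J₀ ∧ ¬ n ≤ e)
    (hT : ∀ a e, e ∈ T a ↔ r e a ∧ e ∉ mons J)
    {S : Set (X ⊕ Y →₀ ℕ)} (hS : S.Nonempty)
    (hSX : ∀ s ∈ S, ∀ y, s (Sum.inr y) = 0) (hM₀ : ∀ e, e ∈ mons J₀ ↔ ∃ s ∈ S, s ≤ e)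
    (hm : ∀ x, m (Sum.inl x) = 0) (hn : ∀ x, n (Sum.inl x) = 0)
    (hn' : ∀ e, e + n ∈ mons J₀ → e ∈ mons J₀)
    (hJ : ∀ w, w ∈ mons J ↔ ∃ κ ∈ mons J₀ ∪ {w | n ≤ w}, w = m + κ)
    (R₀ : SReductions ord J₀ T₀) (R : SReductions ord J T) {N₀ : ℕ}
    (e₀ : StratumRing R₀ ≃ₐ[k] MvPolynomial (Fin N₀) k) :
    Nonempty (StratumRing R ≃ₐ[k] MvPolynomial
      (Fin (N₀ + {b | r b m}.ncard + {b | r b n ∧ b ∉ mons J₀}.ncard)) k) := by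
  classical
  have hT' : ∀ a, ∀ b ∈ T a, r b a := fun a b h => ((hT a b).1 h).1
  have hT₀' : ∀ a, ∀ b ∈ T₀ a, r b a := fun a b h => ((hT₀ a b).1 h).1
  have hfin : ∀ a, (T a).Finite := fun a => (hrfin a).subset (hT' a)
  have hfin₀ : ∀ a, (T₀ a).Finite := fun a => (hrfin a).subset (hT₀' a)
  set D₁ : Set (X ⊕ Y →₀ ℕ) := {b | r b m} with hD₁
  set D₂ : Set (X ⊕ Y →₀ ℕ) := {b | r b n ∧ b ∉ mons J₀} with hD₂
  have hfinD₁ : Finite D₁ := hrfin m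
  have hfinD₂ : Finite D₂ := (hrfin n).subset fun b hb => hb.1
  have := Fintype.ofFinite D₁
  have := Fintype.ofFinite D₂
  have hfinP := finite_params (J := J) hfin
  have hfinP₀ := finite_params (J := J₀) hfin₀
  have hdim : Module.finrank k (tangentSpace R) ≤ N₀ + D₁.ncard + D₂.ncard := by
    let Λ : ((D₁ → k) × (D₂ → k)) × tangentSpace R₀ →ₗ[k] (Params J T → k) :=
      productTangent J₀ J T₀ T m n D₁ D₂ ∘ₗ LinearMap.prodMap LinearMap.id (tangentSpace R₀).subtype
    have hle : tangentSpace R ≤ LinearMap.range Λ := by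
      intro t ht
      obtain ⟨p, t₀, ht₀, h⟩ := exists_productTangent_eq hr hfin₀ hfin hT₀ hT hS hSX hM₀ hm hn hJ
        R₀ R ht
      exact ⟨(p, ⟨t₀, ht₀⟩), h⟩
    have h1 := (Submodule.finrank_mono hle).trans (LinearMap.finrank_range_le Λ)
    have h2 := finrank_tangentSpace_le hr hfin₀ hT₀' R₀ e₀
    rw [Module.finrank_prod, Module.finrank_prod, Module.finrank_fintype_fun_eq_card,
      Module.finrank_fintype_fun_eq_card, ← Nat.card_eq_fintype_card, ← Nat.card_eq_fintype_card,
      Nat.card_coe_set_eq, Nat.card_coe_set_eq] at h1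
    omega
  obtain ⟨g, hg⟩ := exists_surjective_of_finrank_le hr hfin hT' R hdim
  obtain ⟨ρ₀, hρ₀⟩ := exists_coaction hr hfin₀ hT₀' R₀
  obtain ⟨φ, hφ, hφ0⟩ := exists_surjective_product hr hrfin hfin₀ hfin hT₀ hT hS hSX hM₀ hm hn' hJ R₀ R
    (Ideal.Quotient.mkₐ k (stratumIdeal R₀)) (Ideal.Quotient.mkₐ_surjective _ _)
    (fun p hp => Ideal.Quotient.eq_zero_iff_mem.2 hp)
    (fun t ht => ⟨Ideal.Quotient.liftₐ (stratumIdeal R₀) (tangentHom t)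
      (fun p hp => (mem_tangentSpace_iff hr hfin₀ hT₀').1 ht hp), fun p => rfl⟩) ρ₀ hρ₀
  let ψ : StratumRing R →ₐ[k] MvPolynomial (D₁ ⊕ D₂) (StratumRing R₀) :=
    Ideal.Quotient.liftₐ (stratumIdeal R) φ hφ0
  have hψ : Function.Surjective ψ := Ideal.Quotient.lift_surjective_of_surjective _ _ hφ
  have hcard : Nat.card ((D₁ ⊕ D₂) ⊕ Fin N₀) = Nat.card (Fin (N₀ + D₁.ncard + D₂.ncard)) := by
    rw [Nat.card_sum, Nat.card_sum, Nat.card_coe_set_eq, Nat.card_coe_set_eq, Nat.card_fin,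
      Nat.card_fin]
    omega
  obtain ⟨i⟩ := Finite.card_eq.1 hcard
  let ε : MvPolynomial (D₁ ⊕ D₂) (StratumRing R₀) ≃ₐ[k]
      MvPolynomial (Fin (N₀ + D₁.ncard + D₂.ncard)) k :=
    ((mapAlgEquiv _ e₀).trans (sumAlgEquiv k (D₁ ⊕ D₂) (Fin N₀)).symm).trans
      (renameEquiv k i)
  -- The two surjections compose to a surjective endomorphism of the polynomial ring in `N`
  -- variables. Its injectivity forces that of `g`, which is therefore an isomorphism onto the
  -- coordinate ring.
  let χ : MvPolynomial (Fin (N₀ + D₁.ncard + D₂.ncard)) k →ₐ[k]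
      MvPolynomial (Fin (N₀ + D₁.ncard + D₂.ncard)) k := (ε : _ →ₐ[k] _).comp (ψ.comp g)
  have hinj := injective_of_surjective_endo χ.toRingHom (ε.surjective.comp (hψ.comp hg))
  have hginj : Function.Injective g := by
    intro a b hab
    apply hinj
    change ε (ψ (g a)) = ε (ψ (g b))
    rw [hab]
  exact ⟨(AlgEquiv.ofBijective g ⟨hginj, hg⟩).symm⟩

end CoordinateRing

/-! ### Spectra, monomial ideals and the theorem -/

section Affine

/-- Isomorphisms over `k` of spectra of `k`-algebras are isomorphisms of `k`-algebras. -/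
theorem nonempty_over_spec_iso_iff {k A B : Type u} [CommRing k] [CommRing A] [CommRing B]
    [Algebra k A] [Algebra k B] :
    Nonempty (Over.mk (Spec.map (CommRingCat.ofHom (algebraMap k A))) ≅
      Over.mk (Spec.map (CommRingCat.ofHom (algebraMap k B)))) ↔ Nonempty (A ≃ₐ[k] B) := by
  constructor
  · rintro ⟨f⟩
    let g : Spec (CommRingCat.of A) ≅ Spec (CommRingCat.of B) := (Over.forget _).mapIso f
    have hg : g.hom ≫ Spec.map (CommRingCat.ofHom (algebraMap k B)) =
      Spec.map (CommRingCat.ofHom (algebraMap k A)) := Over.w f.hom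
    obtain ⟨h, hh⟩ := Spec.map_surjective g.hom
    have : IsIso (Spec.map h) := hh ▸ inferInstance
    have hiso : IsIso h := by
      have : IsIso (Scheme.Spec.map h.op) := this
      have := isIso_of_fully_faithful Scheme.Spec h.op
      exact (isIso_op_iff h).1 this
    rw [← hh, ← Spec.map_comp] at hg
    have hg' := Spec.map_injective hg
    let e := (asIso h).commRingCatIsoToRingEquiv
    refine ⟨AlgEquiv.symm (AlgEquiv.ofRingEquiv (f := e) fun c => ?_)⟩
    exact congrArg (fun q => q.hom c) hg'
  · rintro ⟨e⟩
    let i : CommRingCat.of B ≅ CommRingCat.of A := e.symm.toRingEquiv.toCommRingCatIso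
    refine ⟨Over.isoMk (Scheme.Spec.mapIso i.op) ?_⟩
    change Spec.map i.hom ≫ Spec.map _ = Spec.map _
    rw [← Spec.map_comp]
    congr 1
    ext c
    exact e.symm.commutes c

variable {k : Type u} [Field k] {σ : Type} {ord : MonomialOrder.{0, v} σ}
  {J : Ideal (MvPolynomial σ k)} {T : (σ →₀ ℕ) → Set (σ →₀ ℕ)}

theorem isAffineSpace_stratum_iff (R : SReductions ord J T) (N : ℕ) :
    IsAffineSpace (stratum R) N ↔ Nonempty (StratumRing R ≃ₐ[k] MvPolynomial (Fin N) k) := by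
  have i : Over.mk (𝔸(ULift.{u} (Fin N); Spec (CommRingCat.of k)) ↘ Spec (CommRingCat.of k)) ≅
      Over.mk (Spec.map (CommRingCat.ofHom
        (algebraMap k (MvPolynomial (ULift.{u} (Fin N)) k)))) :=
    (Over.isoMk (AffineSpace.SpecIso (ULift.{u} (Fin N)) (CommRingCat.of k)).symm
      (AffineSpace.SpecIso_inv_over _)).symm
  have e : MvPolynomial (ULift.{u} (Fin N)) k ≃ₐ[k] MvPolynomial (Fin N) k :=
    renameEquiv k Equiv.ulift
  rw [IsAffineSpace]
  constructor
  · rintro ⟨f⟩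
    obtain ⟨g⟩ := nonempty_over_spec_iso_iff.1 ⟨f ≪≫ i⟩
    exact ⟨g.trans e⟩
  · rintro ⟨g⟩
    obtain ⟨f⟩ := nonempty_over_spec_iso_iff.2 ⟨g.trans e.symm⟩
    exact ⟨f ≪≫ i.symm⟩

end Affine

section MonomialIdeals

variable {k : Type u} [Field k] {σ : Type}

theorem mem_mons_span {S : Set (σ →₀ ℕ)} {e : σ →₀ ℕ} :
    e ∈ mons (Ideal.span ((fun s => monomial s (1 : k)) '' S)) ↔ ∃ s ∈ S, s ≤ e := by
  classical
  rw [mons, Set.mem_ofPred_eq, mem_ideal_span_monomial_image]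
  simp only [mem_support_iff, coeff_monomial, ne_eq, ite_eq_right_iff, one_ne_zero, imp_false,
    not_not, forall_eq']

theorem mem_mons_span_mul {S : Set (σ →₀ ℕ)} {m w : σ →₀ ℕ} :
    w ∈ mons (Ideal.span {monomial m (1 : k)} * Ideal.span ((fun s => monomial s (1 : k)) '' S)) ↔
      ∃ κ, (∃ s ∈ S, s ≤ κ) ∧ w = m + κ := by
  classical
  rw [mons, Set.mem_ofPred_eq, Ideal.mem_span_singleton_mul]
  constructor
  · rintro ⟨z, hz, hw⟩
    have h1 : (monomial m (1 : k) * z).coeff w = 1 := by rw [hw, coeff_monomial, if_pos rfl]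
    rw [coeff_monomial_mul'] at h1
    split_ifs at h1 with h
    · refine ⟨w - m, mem_ideal_span_monomial_image.1 hz _ ?_, (add_tsub_cancel_of_le h).symm⟩
      rw [mem_support_iff]
      intro h0
      rw [h0, mul_zero] at h1
      exact zero_ne_one h1
    · exact absurd h1 zero_ne_one
  · rintro ⟨κ, hκ, rfl⟩
    exact ⟨monomial κ 1, mem_mons_span.2 hκ, by rw [monomial_mul, one_mul]⟩

theorem mons_bot : mons (⊥ : Ideal (MvPolynomial σ k)) = ∅ := by
  ext e
  simp [mons]

theorem finite_degree_eq [Finite σ] (d : ℕ) : {b : σ →₀ ℕ | b.degree = d}.Finite := by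
  classical
  have := Fintype.ofFinite σ
  refine (Set.finite_Iic (Finsupp.equivFunOnFinite.symm fun _ : σ => d)).subset fun b hb i => ?_
  exact (Finsupp.le_degree i b).trans hb.le

end MonomialIdeals

section Product

variable {k : Type u} [Field k] {X Y : Type} [Finite X] [Finite Y] {ord : MonomialOrder.{0, v} (X ⊕ Y)}
  {r : (X ⊕ Y →₀ ℕ) → (X ⊕ Y →₀ ℕ) → Prop}

/-- The stratum of `m ((n₀) + J₀)`, with tails given by the relation `r`, is an affine space if the
stratum of `J₀` relative to `(n₀)` is. Since `n₀` involves only variables in `Y`, multiplication by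
monomials in `X` cannot create multiples of `n₀`, so no condition on the order or on the degree of
`n₀` is needed. -/
theorem isAffineSpace_stratum_product (hr : TailRel ord r) (hfin : ∀ a, {b | r b a}.Finite)
    {S : Set (X →₀ ℕ)} (hS : S.Nonempty) {em en : Y →₀ ℕ}
    {m n₀ : X ⊕ Y →₀ ℕ} (hm : m = em.mapDomain Sum.inr) (hn₀ : n₀ = en.mapDomain Sum.inr)
    {I₀ J₀ J : Ideal (MvPolynomial (X ⊕ Y) k)}
    (hI₀ : I₀ = Ideal.span {monomial n₀ (1 : k)})
    (hJ₀ : J₀ = Ideal.span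
      ((fun s : X →₀ ℕ => monomial (s.mapDomain (Sum.inl : X → X ⊕ Y)) (1 : k)) '' S))
    (hJ : J = Ideal.span {monomial m (1 : k)} * (I₀ ⊔ J₀)) {N₀ : ℕ}
    (R₀ : SReductions ord J₀ fun a => {b | r b a} \ (mons I₀ ∪ mons J₀))
    (R : SReductions ord J fun a => {b | r b a} \ (mons (⊥ : Ideal (MvPolynomial (X ⊕ Y) k)) ∪ mons J))
    (h : IsAffineSpace (stratum R₀) N₀) :
    IsAffineSpace (stratum R) (N₀ + {b | r b m}.ncard + ({b | r b n₀} \ mons J₀).ncard) := by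
  have hinlr : ∀ (e : Y →₀ ℕ) (x : X), e.mapDomain (Sum.inr : Y → X ⊕ Y) (Sum.inl x) = 0 :=
    fun e x => Finsupp.mapDomain_of_notMem_range e _ (by simp)
  have hinrl : ∀ (e : X →₀ ℕ) (y : Y), e.mapDomain (Sum.inl : X → X ⊕ Y) (Sum.inr y) = 0 :=
    fun e y => Finsupp.mapDomain_of_notMem_range e _ (by simp)
  have hmX : ∀ x, m (Sum.inl x) = 0 := fun x => hm ▸ hinlr em x
  have hnX : ∀ x, n₀ (Sum.inl x) = 0 := fun x => hn₀ ▸ hinlr en x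
  set S' : Set (X ⊕ Y →₀ ℕ) := (fun s => s.mapDomain Sum.inl) '' S with hS'
  have hSX : ∀ s ∈ S', ∀ y, s (Sum.inr y) = 0 := by
    rintro _ ⟨s, -, rfl⟩ y
    exact hinrl s y
  have hJ₀' : J₀ = Ideal.span ((fun s => monomial s (1 : k)) '' S') := by
    rw [hJ₀, hS', Set.image_image]
  have hI₀' : I₀ = Ideal.span ((fun s => monomial s (1 : k)) '' {n₀}) := by
    rw [hI₀, Set.image_singleton]
  have hM₀ : ∀ e, e ∈ mons J₀ ↔ ∃ s ∈ S', s ≤ e := fun e => by rw [hJ₀', mem_mons_span]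
  have hMI : ∀ e, e ∈ mons I₀ ↔ n₀ ≤ e := fun e => by rw [hI₀', mem_mons_span]; simp
  have hMJ : ∀ w, w ∈ mons J ↔ ∃ κ ∈ mons J₀ ∪ {w | n₀ ≤ w}, w = m + κ := by
    intro w
    rw [hJ, hI₀', hJ₀', ← Ideal.span_union, ← Set.image_union, mem_mons_span_mul]
    refine exists_congr fun κ => and_congr_left fun _ => ?_
    rw [Set.mem_union, mem_mons_span, Set.mem_ofPred_eq]
    constructor
    · rintro ⟨s, rfl | hs, h⟩
      exacts [Or.inr h, Or.inl ⟨s, hs, h⟩]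
    · rintro (⟨s, hs, h⟩ | h)
      exacts [⟨s, Or.inr hs, h⟩, ⟨n₀, Or.inl rfl, h⟩]
  -- The separation of variables enters here: generators of `J₀` have no variable in `Y` and `n₀`
  -- has none in `X`, so cancelling `n₀` preserves divisibility by a generator.
  have hn' : ∀ e, e + n₀ ∈ mons J₀ → e ∈ mons J₀ := by
    intro e he
    obtain ⟨s, hs, hle⟩ := (hM₀ _).1 he
    refine (hM₀ _).2 ⟨s, hs, ?_⟩
    rintro (x | y)
    · have := hle (Sum.inl x)
      rwa [Finsupp.add_apply, hnX, add_zero] at this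
    · rw [hSX s hs]
      exact Nat.zero_le _
  obtain ⟨e₀⟩ := (isAffineSpace_stratum_iff R₀ N₀).1 h
  refine (isAffineSpace_stratum_iff R _).2 ?_
  refine nonempty_stratumRing_equiv hr hfin (fun a e => ?_) (fun a e => ?_) (hS.image _) hSX hM₀
    hmX hnX hn' hMJ R₀ R e₀
  · rw [Set.mem_sdiff, Set.mem_union, hMI, not_or, and_comm (a := ¬ n₀ ≤ e)]
    rfl
  · rw [Set.mem_sdiff, mons_bot, Set.empty_union]
    rfl

end Product

end

end Strata

theorem theorem5p3 {k : Type*} [Field k] {X Y : Type} [Finite X] [Finite Y]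
    (ord : MonomialOrder (X ⊕ Y))
    -- the exponents of the monomials that generate `J₀`, and those of `m` and `n₀`
    (S : Set (X →₀ ℕ)) (hS : S.Nonempty) (em en : Y →₀ ℕ)
    (m n₀ : X ⊕ Y →₀ ℕ) (hm : m = em.mapDomain Sum.inr) (hn₀ : n₀ = en.mapDomain Sum.inr)
    (I₀ J₀ J : Ideal (MvPolynomial (X ⊕ Y) k))
    (hI₀ : I₀ = Ideal.span {monomial n₀ (1 : k)})
    (hJ₀ : J₀ = Ideal.span
      ((fun s : X →₀ ℕ => monomial (s.mapDomain (Sum.inl : X → X ⊕ Y)) (1 : k)) '' S))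
    (hJ : J = Ideal.span {monomial m (1 : k)} * (I₀ ⊔ J₀))
    (hn : n₀.degree = 1 ∨ Strata.Eliminates ord) (N₀ : ℕ) :
    (Strata.Reliable ord →
      ∀ (R₀ : Strata.SReductions ord J₀ (Strata.stTails ord J₀ I₀))
        (R : Strata.SReductions ord J (Strata.stTails ord J ⊥)),
        Strata.IsAffineSpace (Strata.stratum R₀) N₀ →
        Strata.IsAffineSpace (Strata.stratum R)
          (N₀ + (Strata.tail ord m).ncard + (Strata.tail ord n₀ \ Strata.mons J₀).ncard)) ∧
    (∀ (R₀ : Strata.SReductions ord J₀ (Strata.sthTails ord J₀ I₀))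
        (R : Strata.SReductions ord J (Strata.sthTails ord J ⊥)),
        Strata.IsAffineSpace (Strata.stratum R₀) N₀ →
        Strata.IsAffineSpace (Strata.stratum R)
          (N₀ + (Strata.htail ord m).ncard + (Strata.htail ord n₀ \ Strata.mons J₀).ncard)) := by
  exact ⟨fun hrel => Strata.isAffineSpace_stratum_product (Strata.tailRel_lt ord) hrel hS hm hn₀ hI₀ hJ₀ hJ,
    Strata.isAffineSpace_stratum_product (Strata.tailRel_homogeneous ord)
      (fun a => (Strata.finite_degree_eq a.degree).subset fun b hb => hb.2) hS hm hn₀ hI₀ hJ₀ hJ⟩
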